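/- **Setting.** For $d\ge 1$ let $V=\mathbb R\oplus\mathbb R^{d+1}$ be the simple Euclidean Jordan algebra of rank $2$ and degree $d$, with product $(a,u)\circ(b,v)=(ab+u\cdot v,\;av+bu)$, trace $\mathrm{Tr}(a,u)=2a$ and inner product $\langle x,y\rangle=\mathrm{Tr}(x\circ y)$. Its primitive idempotents are the elements $\tfrac12(1,u)$ with $u$ in the unit sphere of $\mathbb R^{d+1}$; they form the manifold $\Omega_{d+1}$. For $\varepsilon\in\{0,1\}$ and $k\ge 0$ put $$Q_k^\varepsilon(x)=\frac{d+2k+\varepsilon-1}{d+k+\varepsilon-1}\cdot\frac{(d)_{k+\varepsilon}}{(d/2)_{k+\varepsilon}}\,P_k^{(d/2-1,\;d/2-1+\varepsilon)}(2x-1),\qquad R_n^\varepsilon=\sum_{i=0}^{n}Q_i^\varepsilon ,$$ where $P_k^{(a,b)}$ are the Jacobi polynomials and $(y)_n=y(y+1)\cdots(y+n-1)$. For a finite set $X\subset\Omega_{d+1}$ let $A(X)=\{\langle x,y\rangle: x\ne y\in X\}$ be its angle set and $$\mathrm{ann}(x)=\frac{|X|}{\prod_{\alpha\in A(X)}(1-\alpha)}\prod_{\alpha\in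 A(X)}(x-\alpha).$$ For an integer $s\ge1$, $X$ is a *tight $(2s-1)$-design* if $\mathrm{ann}(x)=x\,R^1_{s-1}(x)$. The Bose–Mesner algebra of $X$ is the complex span of the identity matrix $I$ and the $X\times X$ matrices $D_\alpha$, $\alpha\in A(X)$, where $(D_\alpha)_{x,y}=1$ if $\langle x,y\rangle=\alpha$ and $0$ otherwise. Let $(L_i)_{x,y}=Q_i^0(\langle x,y\rangle)/|X|$ for $0\le i<s$, and $L_s=I-\sum_{i<s}L_i$. **Theorem.** Let $d>1$, $s\ge 1$, and let $X\subset\Omega_{d+1}$ be a tight $(2s-1)$-design. 1. If $(d,s)\ne(2,3)$, then the angle set of $X$ is rational: $A(X)\subset\mathbb Q$. 2. The matrices $L_0,\dots,L_s$ form a basis of the Bose–Mesner algebra of $X$ and satisfy $L_iL_j=\delta_{ij}L_i$. Moreover $\operatorname{rank}L_s=\binom{d+s-2}{s-1}$. If $s\ge2$, then $\operatorname{rank}L_1=d+1$, and $\operatorname{rank}L_1=\operatorname{rank}L_s$ if and only if $d=2$ and $s=3$. In the exceptional case $d=2$, $s=3$: tight $5$-designs in $\Omega_3$ exist; a finite set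 of primitive idempotents is a tight $5$-design in $\Omega_3$ if and only if the corresponding subset of the unit sphere of $\mathbb R^3$ is the vertex set of a regular icosahedron; and the angle set of every such design is not contained in $\mathbb Q$. -/

import Mathlib

open Polynomial

noncomputable section

/-! ### The rank two simple Euclidean Jordan algebras and their primitive idempotents -/

/-- The simple Euclidean Jordan algebra of rank `2` and degree `d`: the spin factor
`ℝ ⊕ ℝ^(d+1)`, with `ℝ^(d+1)` carrying its Euclidean inner product. -/
abbrev SpinFactor (d : ℕ) : Type := ℝ × EuclideanSpace ℝ (Fin (d + 1))

namespace SpinFactor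

variable {d : ℕ}

/-- The Jordan product `(a, u) ∘ (b, v) = (a b + ⟪u, v⟫, a v + b u)`. -/
def jmul (x y : SpinFactor d) : SpinFactor d :=
  (x.1 * y.1 + inner ℝ x.2 y.2, x.1 • y.2 + y.1 • x.2)

/-- The Jordan trace of the spin factor, `Tr (a, u) = 2 a`. -/
def trace (x : SpinFactor d) : ℝ := 2 * x.1

/-- The Jordan determinant of the spin factor, `det (a, u) = a² - ‖u‖²`. -/
def det (x : SpinFactor d) : ℝ := x.1 ^ 2 - ‖x.2‖ ^ 2

theorem jmul_comm (x y : SpinFactor d) : jmul x y = jmul y x := by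
  ext1
  · simp [jmul, mul_comm, real_inner_comm]
  · simp [jmul, add_comm]

/-- The Jordan identity `(x ∘ y) ∘ x² = x ∘ (y ∘ x²)`. -/
theorem jordan_identity (x y : SpinFactor d) :
    jmul (jmul x y) (jmul x x) = jmul x (jmul y (jmul x x)) := by
  ext1
  · simp only [jmul, inner_add_left, inner_add_right, real_inner_smul_left,
      real_inner_smul_right, real_inner_comm x.2 y.2]
    ring
  · simp only [jmul, inner_add_right, real_inner_smul_right, real_inner_comm x.2 y.2]
    module

/-- Every element satisfies `x² - Tr(x) x + det(x) e = 0` with `e = (1, 0)`, which is the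
characteristic equation that determines the Jordan trace. -/
theorem characteristic_equation (x : SpinFactor d) :
    jmul x x - trace x • x + det x • ((1, 0) : SpinFactor d) = 0 := by
  ext1
  · simp [jmul, trace, det]
    ring
  · simp only [jmul, trace, det, Prod.snd_add, Prod.snd_sub, Prod.smul_snd, Prod.snd_zero]
    module

/-- The Euclidean inner product `⟨x, y⟩ = Tr (x ∘ y)`. -/
def ip (x y : SpinFactor d) : ℝ := trace (jmul x y)

/-- `c` is an idempotent for the Jordan product. -/
def IsIdem (c : SpinFactor d) : Prop := jmul c c = c

/-- `c` is a primitive idempotent: a nonzero idempotent that is not the sum of two nonzero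
orthogonal idempotents. The set of these is the manifold `𝒥(V) ≅ Ω_{d+1}`. -/
def IsPrimitiveIdem (c : SpinFactor d) : Prop :=
  IsIdem c ∧ c ≠ 0 ∧
    ¬ ∃ a b : SpinFactor d,
        IsIdem a ∧ IsIdem b ∧ a ≠ 0 ∧ b ≠ 0 ∧ jmul a b = 0 ∧ a + b = c

/-- The primitive idempotent `(1/2)(1, u)` that corresponds to the point `u` of the unit
sphere of `ℝ^(d+1)`. -/
def ofSphere (u : EuclideanSpace ℝ (Fin (d + 1))) : SpinFactor d :=
  (1 / 2, (1 / 2 : ℝ) • u)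

end SpinFactor

/-! ### Renormalized Jacobi polynomials -/

/-- The Pochhammer symbol `(x)_n = x (x+1) ⋯ (x+n-1)`. -/
def poch (x : ℝ) (n : ℕ) : ℝ := (ascPochhammer ℝ n).eval x

/-- The Jacobi polynomial `P_n^{(a,b)}`, in the form
`(1/n!) ∑_k C(n,k) (n+a+b+1)_k (a+k+1)_{n-k} ((X-1)/2)^k`. -/
def jacobi (a b : ℝ) (n : ℕ) : ℝ[X] :=
  C (1 / (n.factorial : ℝ)) *
    ∑ k ∈ Finset.range (n + 1),
      C ((n.choose k : ℝ) * poch (n + a + b + 1) k * poch (a + k + 1) (n - k)) *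
        (C (1 / 2) * (X - 1)) ^ k

/-- The renormalized Jacobi polynomial `Q_k^ε` for rank `ρ` and degree `d` (used for
`(ρ, d) ≠ (2, 1)`, where no denominator vanishes). -/
def jacobiQ (ρ d ε k : ℕ) : ℝ[X] :=
  C (((ρ * d / 2 + 2 * k + ε - 1 : ℝ) / (ρ * d / 2 + k + ε - 1 : ℝ)) *
      (poch (ρ * d / 2) (k + ε) / poch (d / 2) (k + ε))) *
    (jacobi ((d : ℝ) / 2 * (ρ - 1) - 1) ((d : ℝ) / 2 - 1 + ε) k).comp (2 * X - 1)

/-- `R_n^ε = ∑_{i ≤ n} Q_i^ε`. -/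
def jacobiR (ρ d ε n : ℕ) : ℝ[X] := ∑ i ∈ Finset.range (n + 1), jacobiQ ρ d ε i

/-! ### Angle sets and tight designs -/

section Designs

variable {d : ℕ}

open Classical in
/-- The angle set `A(X) = {⟨x, y⟩ : x ≠ y in X}`. -/
def angleSet (X : Finset (SpinFactor d)) : Finset ℝ :=
  X.offDiag.image fun p => SpinFactor.ip p.1 p.2

/-- The annihilator polynomial
`ann = |X| / ∏_{α ∈ A(X)} (1 - α) * ∏_{α ∈ A(X)} (x - α)`. -/
def annihilator (X : Finset (SpinFactor d)) : ℝ[X] :=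
  C ((X.card : ℝ) / ∏ α ∈ angleSet X, (1 - α)) *
    ∏ α ∈ angleSet X, (Polynomial.X - C α)

/-- `X` is a tight `(2s - ε)`-design in `Ω_{d+1}` (`ε = 0, 1`): a finite set of primitive
idempotents with `ann(x) = x^ε R_{s-ε}^ε(x)`. -/
def IsTightDesign (s ε : ℕ) (X : Finset (SpinFactor d)) : Prop :=
  ε ≤ 1 ∧ ε ≤ s ∧ (∀ x ∈ X, SpinFactor.IsPrimitiveIdem x) ∧
    annihilator X = Polynomial.X ^ ε * jacobiR 2 d ε (s - ε)

/-! ### The Bose-Mesner algebra and its idempotents -/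

/-- The adjacency matrix `D_α` of the graph on `X` that joins `x, y` when `⟨x, y⟩ = α`. -/
def adjacency (X : Finset (SpinFactor d)) (α : ℝ) : Matrix X X ℂ :=
  Matrix.of fun x y => if SpinFactor.ip x.1 y.1 = α then 1 else 0

open Classical in
/-- The Bose-Mesner algebra of `X`: the complex span of `I` and the `D_α`, `α ∈ A(X)`. -/
def boseMesner (X : Finset (SpinFactor d)) : Submodule ℂ (Matrix X X ℂ) :=
  Submodule.span ℂ (insert 1 (adjacency X '' (angleSet X : Set ℝ)))

/-- The matrix `E_i` with entries `Q_i^0(⟨x, y⟩) / |X|`. -/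
def jacobiMatrix (X : Finset (SpinFactor d)) (i : ℕ) : Matrix X X ℂ :=
  Matrix.of fun x y =>
    (((jacobiQ 2 d 0 i).eval (SpinFactor.ip x.1 y.1) / (X.card : ℝ) : ℝ) : ℂ)

open Classical in
/-- The matrices `L_0, …, L_s`: `L_i = E_i` for `i < s`, and `L_s = I - ∑_{i < s} E_i`. -/
def schemeIdempotent (X : Finset (SpinFactor d)) (s i : ℕ) : Matrix X X ℂ :=
  if i < s then jacobiMatrix X i
  else 1 - ∑ j ∈ Finset.range s, jacobiMatrix X j

end Designs

/-! ### The regular icosahedron -/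

/-- The vertices of a regular icosahedron inscribed in the unit sphere of `ℝ³`: the cyclic
permutations of `(0, ±1, ±φ)`, divided by `√(1 + φ²)`. -/
def icosahedronVertices : Set (EuclideanSpace ℝ (Fin 3)) :=
  {v | ∃ a ∈ ({1, -1} : Set ℝ), ∃ b ∈ ({1, -1} : Set ℝ),
    ∃ w ∈ ({!₂[0, a, b * Real.goldenRatio], !₂[a, b * Real.goldenRatio, 0],
        !₂[b * Real.goldenRatio, 0, a]} : Set (EuclideanSpace ℝ (Fin 3))),
      v = (√(1 + Real.goldenRatio ^ 2))⁻¹ • w}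

/-- `X` is the vertex set of a regular icosahedron in `Ω_3`. -/
def IsRegularIcosahedron (X : Finset (SpinFactor 2)) : Prop :=
  ∃ f : EuclideanSpace ℝ (Fin 3) ≃ₗᵢ[ℝ] EuclideanSpace ℝ (Fin 3),
    (X : Set (SpinFactor 2)) = (fun v => SpinFactor.ofSphere (f v)) '' icosahedronVertices

end

noncomputable section

/-! ### The Pochhammer symbol -/

/-! Write `s = n + 1` and let `E_i` be the matrix with entries `Q_i^0(⟨x, y⟩) / |X|`. On pairs of
points of `X` the annihilator is `|X|` on the diagonal and `0` elsewhere. Since `x R_n^1 = ∑_{i ≤ n}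
Q_i^0 + c Q_{n+1}^0` with `c = (n + 1)/(2n + d + 1) > 0` (`X_mul_jacobiR_one`), tightness yields `1
= ∑_{i ≤ n} E_i + c E_{n+1}` (`sum_kernelMatrix`). Every `E_i` is positive semidefinite
(`posSemidef_jacobi_inner`), so sums of distinct `E_i`, `i ≤ n`, are at most `1`.

The sum `S_i = E_i + E_{i-2} + ⋯` comes from homogeneous polynomials of degree `i` in `d + 1`
variables. Its rank is at most `C(d+i, i)`, which is exactly its trace. A matrix between `0` and `1`
whose rank is at most its trace is a projection, so the `S_i` are projections, hence so are their
differences `E_i`; and `E_i + E_j ≤ 1` makes them orthogonal. With the complement `L_s` they are `s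
+ 1` nonzero orthogonal idempotents in a space of dimension at most `|A(X)| + 1 ≤ s + 1`, hence a
basis. Ranks are traces, read off from `Q_i^0(1)` and `|X| = 2 C(d+n, n)`.

For rationality, all entries of the `L_i` are algebraic, and every embedding of the algebraic
numbers permutes the `L_i` and preserves their traces (`rational_of_unique_trace`). For `s ≥ 2` the
rank `d + 1` of `L_1` occurs only once unless `d = 2`, `s = 3`. Then `L_1` is rational, and its
entries are affine in the angles.

For `d = 2`, `s = 3` the possible cosines are `-1` and `±1/√5`, and `|X| = 12`. Counting gives every
point at least four neighbours at cosine `1/√5`, and two of these are adjacent (`exists_triangle`).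
Such a triangle fixes a frame in which each point of `X` must be a vertex of the standard
icosahedron, and equal cardinalities finish. -/

theorem poch_zero (x : ℝ) : poch x 0 = 1 := by simp [poch]

theorem poch_succ (x : ℝ) (n : ℕ) : poch x (n + 1) = poch x n * (x + n) :=
  ascPochhammer_succ_eval n x

theorem poch_succ_left (x : ℝ) (n : ℕ) : poch x (n + 1) = x * poch (x + 1) n := by
  simp [poch, ascPochhammer_succ_left, eval_comp]

theorem poch_pos {x : ℝ} (hx : 0 < x) (n : ℕ) : 0 < poch x n := ascPochhammer_pos n x hx

/-! ### Jacobi polynomials as functions of `z = (t - 1) / 2` -/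

/-- The coefficient of `((X - 1) / 2) ^ k` in the Jacobi polynomial `P_n^{(a,b)}`. -/
def jacobiCoeff (a b : ℝ) (n k : ℕ) : ℝ :=
  1 / (n.factorial : ℝ) * ((n.choose k : ℝ) * poch (n + a + b + 1) k * poch (a + k + 1) (n - k))

/-- The Jacobi polynomial in the variable `z = (t - 1) / 2`. -/
def jacobiZ (a b : ℝ) (n : ℕ) : ℝ[X] :=
  ∑ k ∈ Finset.range (n + 1), C (jacobiCoeff a b n k) * X ^ k

theorem jacobiCoeff_of_lt {a b : ℝ} {n k : ℕ} (h : n < k) : jacobiCoeff a b n k = 0 := by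
  simp [jacobiCoeff, Nat.choose_eq_zero_of_lt h]

theorem coeff_jacobiZ (a b : ℝ) (n k : ℕ) : (jacobiZ a b n).coeff k = jacobiCoeff a b n k := by
  simp only [jacobiZ, finsetSum_coeff, coeff_C_mul_X_pow, Finset.sum_ite_eq, Finset.mem_range]
  split_ifs with h
  · rfl
  · rw [jacobiCoeff_of_lt (by omega)]

theorem jacobi_eq_comp (a b : ℝ) (n : ℕ) :
    jacobi a b n = (jacobiZ a b n).comp (C (1 / 2) * (X - 1)) := by
  simp only [jacobi, jacobiZ, sum_comp, Finset.mul_sum, mul_comp, C_comp, pow_comp, X_comp]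
  refine Finset.sum_congr rfl fun k _ => ?_
  rw [jacobiCoeff, C_mul (a := 1 / (n.factorial : ℝ))]
  ring

/-- Indexing by `k + m` removes the truncated subtraction `n - k`; the coefficient identities below
use this form. -/
theorem jacobiCoeff_add (a b : ℝ) (k m : ℕ) :
    jacobiCoeff a b (k + m) k =
      poch ((k + m : ℕ) + a + b + 1) k * poch (a + k + 1) m / (k.factorial * m.factorial) := by
  rw [jacobiCoeff, Nat.cast_add_choose, Nat.add_sub_cancel_left]
  have h1 : ((k + m).factorial : ℝ) ≠ 0 := by positivity
  have h2 : (k.factorial : ℝ) ≠ 0 := by positivity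
  have h3 : (m.factorial : ℝ) ≠ 0 := by positivity
  field_simp

theorem jacobiCoeff_self (a b : ℝ) (k : ℕ) :
    jacobiCoeff a b k k = poch (k + a + b + 1) k / k.factorial := by
  have := jacobiCoeff_add a b k 0
  simpa [poch_zero] using this

theorem jacobiCoeff_zero (a b : ℝ) (n : ℕ) :
    jacobiCoeff a b n 0 = poch (a + 1) n / n.factorial := by
  have := jacobiCoeff_add a b 0 n
  simpa [poch_zero] using this

/-- The contiguous relation that makes the sums of the `jacobiQ` telescope. -/
theorem jacobiZ_contiguous (a b : ℝ) (n : ℕ) :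
    C (2 * n + a + b + 3) * jacobiZ a b (n + 1) =
      C (n + a + b + 2) * jacobiZ (a + 1) b (n + 1) - C (n + b + 1) * jacobiZ (a + 1) b n := by
  ext k
  simp only [coeff_sub, coeff_C_mul, coeff_jacobiZ]
  rcases lt_trichotomy k (n + 1) with h | rfl | h
  · obtain ⟨m, rfl⟩ := Nat.exists_eq_add_of_le (Nat.lt_succ_iff.mp h)
    rw [add_assoc k m 1, jacobiCoeff_add, jacobiCoeff_add, jacobiCoeff_add, Nat.factorial_succ]
    have e1 : poch (a + k + 1) (m + 1) = (a + k + 1) * poch (a + 1 + k + 1) m := by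
      rw [poch_succ_left]; ring_nf
    have e2 := poch_succ (a + 1 + k + 1) m
    -- Splitting off the last or the first factor gives `(y)_k (y + k) = y (y + 1)_k`; the
    -- contiguous relation reduces to this.
    have e3 := (poch_succ ((k : ℝ) + m + a + b + 2) k).symm.trans (poch_succ_left _ _)
    rw [e1, e2]
    push_cast
    have f1 : (k : ℝ) + (m + 1) + a + b + 1 = k + m + a + b + 2 := by ring
    have f2 : (k : ℝ) + (m + 1) + (a + 1) + b + 1 = k + m + a + b + 2 + 1 := by ring
    have f3 : (k : ℝ) + m + (a + 1) + b + 1 = k + m + a + b + 2 := by ring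
    rw [f1, f2, f3]
    have h2 : (k.factorial : ℝ) ≠ 0 := by positivity
    have h3 : (m.factorial : ℝ) ≠ 0 := by positivity
    have h4 : (m : ℝ) + 1 ≠ 0 := by positivity
    field_simp
    linear_combination (poch (a + 1 + k + 1) m * (a + 1 + k + 1 + m)) * e3
  · rw [jacobiCoeff_self, jacobiCoeff_self, jacobiCoeff_of_lt (Nat.lt_succ_self n)]
    push_cast
    have e3 := (poch_succ ((n : ℝ) + a + b + 2) (n + 1)).symm.trans (poch_succ_left _ _)
    have f1 : (n : ℝ) + 1 + a + b + 1 = n + a + b + 2 := by ring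
    have f2 : (n : ℝ) + 1 + (a + 1) + b + 1 = n + a + b + 2 + 1 := by ring
    rw [f1, f2]
    push_cast at e3
    have h2 : ((n + 1).factorial : ℝ) ≠ 0 := by positivity
    field_simp
    linear_combination e3
  · rw [jacobiCoeff_of_lt h, jacobiCoeff_of_lt h, jacobiCoeff_of_lt (by omega)]
    ring

/-- The relation that expands `x * R_n^1` in the `Q_i^0`. -/
theorem X_add_one_mul_jacobiZ (a : ℝ) (n : ℕ) :
    C (n + 2 * a + 2) * ((X + 1) * jacobiZ (a + 1) (a + 1) n) =
      C (a + n + 1) * jacobiZ (a + 1) a n + C (n + 1 : ℝ) * jacobiZ a a (n + 1) := by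
  ext k
  rw [add_mul, one_mul]
  simp only [coeff_add, coeff_C_mul, coeff_jacobiZ]
  cases k with
  | zero =>
    rw [coeff_X_mul_zero]
    simp only [jacobiCoeff_zero]
    have h2 : (n.factorial : ℝ) ≠ 0 := by positivity
    have h4 : (n : ℝ) + 1 ≠ 0 := by positivity
    rw [poch_succ_left (a + 1), Nat.factorial_succ]
    have e := (poch_succ (a + 1) n).symm.trans (poch_succ_left _ _)
    push_cast
    field_simp
    ring
  | succ i =>
    rw [coeff_X_mul, coeff_jacobiZ]
    rcases lt_trichotomy i n with h | rfl | h
    · obtain ⟨m, rfl⟩ := Nat.exists_eq_add_of_le (Nat.succ_le_of_lt h)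
      rw [Nat.succ_eq_add_one, add_assoc (i + 1) m 1, jacobiCoeff_add, jacobiCoeff_add,
        jacobiCoeff_add, show i + 1 + m = i + (m + 1) by ring, jacobiCoeff_add]
      push_cast [Nat.factorial_succ]
      have e1 : poch (a + (i + 1) + 1) (m + 1) = (a + i + 2) * poch (a + i + 3) m := by
        rw [poch_succ_left]; ring_nf
      have e2 : (a + 1 + (i + 1) + 1 : ℝ) = a + i + 3 := by ring
      have e4 : (a + 1 + i + 1 : ℝ) = a + (i + 1) + 1 := by ring
      set A := poch ((i : ℝ) + m + 2 * a + 4) i with hA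
      have g1 : poch ((i : ℝ) + (m + 1) + (a + 1) + (a + 1) + 1) (i + 1) =
          A * (i + m + 2 * a + 4 + i) := by
        rw [poch_succ, hA]; ring_nf
      have g2 : poch ((i : ℝ) + (m + 1) + (a + 1) + a + 1) (i + 1) =
          (i + m + 2 * a + 3) * A := by
        rw [poch_succ_left, hA]; ring_nf
      have g3 : poch ((i : ℝ) + 1 + (m + 1) + a + a + 1) (i + 1) =
          (i + m + 2 * a + 3) * A := by
        rw [poch_succ_left, hA]; ring_nf
      have g4 : poch ((i : ℝ) + (m + 1) + (a + 1) + (a + 1) + 1) i = A := by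
        rw [hA]; ring_nf
      rw [e2, e4, e1, g1, g2, g3, g4]
      have h2 : (i.factorial : ℝ) ≠ 0 := by positivity
      have h3 : (m.factorial : ℝ) ≠ 0 := by positivity
      have h4 : (m : ℝ) + 1 ≠ 0 := by positivity
      have h5 : (i : ℝ) + 1 ≠ 0 := by positivity
      field_simp
      ring
    · rw [jacobiCoeff_self, jacobiCoeff_self, jacobiCoeff_of_lt (Nat.lt_succ_self i),
        jacobiCoeff_of_lt (Nat.lt_succ_self i), Nat.factorial_succ]
      push_cast
      have g3 : poch ((i : ℝ) + 1 + a + a + 1) (i + 1) =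
          (i + 2 * a + 2) * poch (i + (a + 1) + (a + 1) + 1) i := by
        rw [poch_succ_left]; ring_nf
      rw [g3]
      have h2 : (i.factorial : ℝ) ≠ 0 := by positivity
      have h5 : (i : ℝ) + 1 ≠ 0 := by positivity
      field_simp
      ring
    · rw [jacobiCoeff_of_lt h, jacobiCoeff_of_lt (by omega), jacobiCoeff_of_lt (by omega),
        jacobiCoeff_of_lt (by omega)]
      ring

/-! ### Sums of the polynomials `Q_k^ε` in rank two -/

/-- The argument `t = 2x - 1` gives `z = (t - 1)/2 = x - 1`. For `ε = 0` the two Jacobi parameters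
coincide, so `Q_k^0` has the parity of `k` in `t`. -/
theorem jacobiQ_two (d ε k : ℕ) :
    jacobiQ 2 d ε k = C (((d + 2 * k + ε - 1 : ℝ) / (d + k + ε - 1)) *
      (poch d (k + ε) / poch (d / 2) (k + ε))) *
      (jacobiZ ((d : ℝ) / 2 - 1) ((d : ℝ) / 2 - 1 + ε) k).comp (X - 1) := by
  have e : ((2 : ℕ) : ℝ) * d / 2 = d := by push_cast; ring
  have e2 : (d : ℝ) / 2 * ((2 : ℕ) - 1) - 1 = d / 2 - 1 := by push_cast; ring
  have e3 : (C (1 / 2) * (X - 1) : ℝ[X]).comp (2 * X - 1) = X - 1 := by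
    have h2 : (2 : ℝ[X]) = C 2 := rfl
    simp only [mul_comp, C_comp, sub_comp, X_comp, one_comp, h2]
    rw [sub_sub, show (1 : ℝ[X]) + 1 = C 2 from one_add_one_eq_two, ← mul_sub_one, ← mul_assoc,
      ← C_mul]
    norm_num
  rw [jacobiQ, jacobi_eq_comp, comp_assoc, e, e2, e3]

theorem jacobiQ_zero {d : ℕ} (hd : 1 < d) (ε : ℕ) :
    jacobiQ 2 d ε 0 = C (poch d ε / poch (d / 2) ε) := by
  have h : (d : ℝ) + ε - 1 ≠ 0 := by
    have : (1 : ℝ) < d := by exact_mod_cast hd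
    have : (0 : ℝ) ≤ ε := by positivity
    linarith
  rw [jacobiQ_two]
  simp [jacobiZ, jacobiCoeff, poch_zero, div_self h]

/-- The normalisation of `Q_k^ε` makes `jacobiZ_contiguous` telescope, so the sum is one Jacobi
polynomial with its first parameter raised by one. -/
theorem jacobiR_two {d : ℕ} (hd : 1 < d) (ε n : ℕ) :
    jacobiR 2 d ε n = C (poch d (n + ε) / poch (d / 2) (n + ε)) *
      (jacobiZ ((d : ℝ) / 2) ((d : ℝ) / 2 - 1 + ε) n).comp (X - 1) := by
  have hd1 : (1 : ℝ) < d := by exact_mod_cast hd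
  have hε : (0 : ℝ) ≤ ε := by positivity
  induction n with
  | zero =>
    rw [jacobiR, Finset.sum_range_one, jacobiQ_zero hd]
    simp [jacobiZ, jacobiCoeff, poch_zero]
  | succ n ih =>
    rw [jacobiR, Finset.sum_range_succ, ← jacobiR, ih, jacobiQ_two]
    have hn : (0 : ℝ) ≤ n := by positivity
    have hc := congrArg (fun p => p.comp (X - 1))
      (jacobiZ_contiguous ((d : ℝ) / 2 - 1) ((d : ℝ) / 2 - 1 + ε) n)
    simp only [mul_comp, C_comp, sub_comp, sub_add_cancel] at hc
    have h1 : (d : ℝ) + (n + 1 : ℕ) + ε - 1 ≠ 0 := by push_cast; linarith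
    have h2 : poch ((d : ℝ) / 2) (n + 1 + ε) ≠ 0 := (poch_pos (by linarith) _).ne'
    have h3 : poch ((d : ℝ) / 2) (n + ε) ≠ 0 := (poch_pos (by linarith) _).ne'
    have h5 : (d : ℝ) / 2 + n + ε ≠ 0 := by linarith
    have h6 : (d : ℝ) + n + ε ≠ 0 := by linarith
    set K : ℝ := poch d (n + 1 + ε) / poch (d / 2) (n + 1 + ε) with hK
    have hK' : poch (d : ℝ) (n + ε) / poch (d / 2) (n + ε) =
        (1 / (d + (n + 1 : ℕ) + ε - 1)) * K * (n + ((d : ℝ) / 2 - 1 + ε) + 1) := by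
      have e1 : n + 1 + ε = (n + ε) + 1 := by ring
      rw [hK, e1, poch_succ, poch_succ]
      push_cast
      rw [show (d : ℝ) + (n + 1) + ε - 1 = d + n + ε by ring,
        show (d : ℝ) / 2 + (n + ε) = d / 2 + n + ε by ring,
        show (d : ℝ) + (n + ε) = d + n + ε by ring]
      field_simp
      ring
    have hL : (d + 2 * (n + 1 : ℕ) + ε - 1 : ℝ) / (d + (n + 1 : ℕ) + ε - 1) * K =
        (1 / (d + (n + 1 : ℕ) + ε - 1)) * K * (2 * n + ((d : ℝ) / 2 - 1) + (d / 2 - 1 + ε) + 3) := by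
      push_cast
      ring
    have hM : (1 / (d + (n + 1 : ℕ) + ε - 1)) * K * (n + ((d : ℝ) / 2 - 1) + (d / 2 - 1 + ε) + 2) =
        K := by
      have : (n + ((d : ℝ) / 2 - 1) + (d / 2 - 1 + ε) + 2) = d + (n + 1 : ℕ) + ε - 1 := by
        push_cast; ring
      rw [this]
      field_simp
    rw [hL, hK', C_mul, C_mul (b := (2 * n + ((d : ℝ) / 2 - 1) + (d / 2 - 1 + ε) + 3))]
    conv_rhs => rw [← hM]
    rw [C_mul (b := (n + ((d : ℝ) / 2 - 1) + (d / 2 - 1 + ε) + 2))]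
    linear_combination C (1 / (d + (n + 1 : ℕ) + ε - 1 : ℝ) * K) * hc

/-- The expansion of `x R_n^1` in the polynomials `Q_i^0`. -/
theorem X_mul_jacobiR_one {d : ℕ} (hd : 1 < d) (n : ℕ) :
    X * jacobiR 2 d 1 n = ∑ i ∈ Finset.range (n + 1), jacobiQ 2 d 0 i +
      C ((n + 1 : ℝ) / (2 * n + d + 1)) * jacobiQ 2 d 0 (n + 1) := by
  have hd1 : (1 : ℝ) < d := by exact_mod_cast hd
  have hn : (0 : ℝ) ≤ n := by positivity
  -- With `a = d/2 - 1` the three polynomials are, up to constants, `R_n^1`, `R_n^0` and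
  -- `Q_{n+1}^0`, and the factor `X + 1` becomes `x`.
  have hc := congrArg (fun p => p.comp (X - 1)) (X_add_one_mul_jacobiZ ((d : ℝ) / 2 - 1) n)
  simp only [mul_comp, C_comp, add_comp, sub_add_cancel, X_comp, one_comp] at hc
  have h2 : poch ((d : ℝ) / 2) n ≠ 0 := (poch_pos (by linarith) _).ne'
  have h5 : (d : ℝ) / 2 + n ≠ 0 := by linarith
  have h6 : (d : ℝ) + n ≠ 0 := by linarith
  have h7 : (2 * n + d + 1 : ℝ) ≠ 0 := by linarith
  rw [← jacobiR, jacobiR_two hd, jacobiR_two hd, jacobiQ_two]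
  simp only [Nat.cast_zero, Nat.cast_one, add_zero, sub_add_cancel]
  set K : ℝ := poch d (n + 1) / poch (d / 2) (n + 1) with hK
  have hK1 : K = K / (n + d) * (n + 2 * (d / 2 - 1) + 2) := by
    rw [show (n + 2 * ((d : ℝ) / 2 - 1) + 2) = d + n by ring, add_comm (n : ℝ)]
    field_simp
  have hK2 : poch (d : ℝ) n / poch (d / 2) n = K / (n + d) * (d / 2 - 1 + n + 1) := by
    rw [hK, poch_succ, poch_succ, show (d : ℝ) / 2 - 1 + n + 1 = d / 2 + n by ring,
      add_comm (n : ℝ)]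
    field_simp
  have hK3 : (n + 1 : ℝ) / (2 * n + d + 1) *
      ((d + 2 * (n + 1 : ℕ) - 1) / (d + (n + 1 : ℕ) - 1) * K) = K / (n + d) * (n + 1) := by
    push_cast
    rw [show (d : ℝ) + 2 * (n + 1) - 1 = 2 * n + d + 1 by ring,
      show (d : ℝ) + (n + 1) - 1 = d + n by ring, add_comm (n : ℝ) d]
    field_simp
  rw [hK2, ← mul_assoc (C ((n + 1 : ℝ) / (2 * n + d + 1))), ← C_mul, hK3]
  conv_lhs => rw [hK1]
  rw [C_mul, C_mul (b := (d / 2 - 1 + n + 1 : ℝ)), C_mul (b := (n + 1 : ℝ))]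
  linear_combination C (K / (n + d)) * hc

/-! ### Values at one, degrees and rationality -/

theorem eval_one_jacobiZ_comp (a b : ℝ) (n : ℕ) :
    ((jacobiZ a b n).comp (X - 1)).eval 1 = poch (a + 1) n / n.factorial := by
  rw [eval_comp]
  simp only [eval_sub, eval_X, eval_one, sub_self]
  rw [← coeff_zero_eq_eval_zero, coeff_jacobiZ, jacobiCoeff_zero]

theorem poch_natCast (d n : ℕ) : poch (d : ℝ) n = n.factorial * (d + n - 1).choose n := by
  rw [poch, ascPochhammer_nat_eq_natCast_ascFactorial, Nat.ascFactorial_eq_factorial_mul_choose']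
  push_cast; rfl

theorem eval_one_jacobiQ {d : ℕ} (hd : 1 < d) (k : ℕ) :
    (jacobiQ 2 d 0 k).eval 1 = (d + 2 * k - 1) / (d + k - 1) * (d + k - 1).choose k := by
  have hd1 : (1 : ℝ) < d := by exact_mod_cast hd
  have h2 : poch ((d : ℝ) / 2) k ≠ 0 := (poch_pos (by linarith) _).ne'
  rw [jacobiQ_two, eval_mul, eval_C, eval_one_jacobiZ_comp]
  simp only [Nat.cast_zero, add_zero, sub_add_cancel]
  rw [poch_natCast]
  field_simp

theorem eval_one_jacobiQ_zero {d : ℕ} (hd : 1 < d) : (jacobiQ 2 d 0 0).eval 1 = 1 := by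
  rw [jacobiQ_zero hd]; simp [poch_zero]

theorem eval_one_jacobiQ_one {d : ℕ} (hd : 1 < d) : (jacobiQ 2 d 0 1).eval 1 = d + 1 := by
  have hd1 : (1 : ℝ) < d := by exact_mod_cast hd
  rw [eval_one_jacobiQ hd]
  simp
  field_simp
  ring

theorem eval_one_jacobiQ_succ {d : ℕ} (hd : 1 < d) (k : ℕ) :
    (jacobiQ 2 d 0 (k + 1)).eval 1 = (d + k).choose (k + 1) + (d + k - 1).choose k := by
  have hd1 : (1 : ℝ) < d := by exact_mod_cast hd
  have hk : (0 : ℝ) ≤ k := by positivity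
  rw [eval_one_jacobiQ hd]
  obtain ⟨e, rfl⟩ : ∃ e, d = e + 1 := ⟨d - 1, by omega⟩
  have h := Nat.add_one_mul_choose_eq (e + k) k
  have h' : ((e + k : ℕ) + 1 : ℝ) * (e + k).choose k = (e + k + 1).choose (k + 1) * (k + 1 : ℕ) := by
    exact_mod_cast h
  rw [show e + 1 + (k + 1) - 1 = e + k + 1 by omega, show e + 1 + k - 1 = e + k by omega,
    show e + 1 + k = e + k + 1 by omega]
  push_cast at h' hd1 ⊢
  have : (e : ℝ) + 1 + (k + 1) - 1 ≠ 0 := by linarith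
  field_simp
  linear_combination -h'

/-- The dimension count behind `Pol_{k+2} = Harm_{k+2} ⊕ |x|² Pol_k` in `d + 1` variables. -/
theorem eval_one_jacobiQ_add_two {d : ℕ} (hd : 1 < d) (k : ℕ) :
    (jacobiQ 2 d 0 (k + 2)).eval 1 + (d + k).choose k = (d + (k + 2)).choose (k + 2) := by
  rw [eval_one_jacobiQ_succ hd, show d + (k + 1) - 1 = d + k by omega,
    show d + (k + 1) = d + k + 1 by omega, show d + (k + 2) = d + k + 1 + 1 by omega,
    Nat.choose_succ_succ (d + k + 1) (k + 1), Nat.choose_succ_succ (d + k) k]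
  push_cast
  rw [Nat.choose_succ_succ (d + k) (k + 1)]
  push_cast
  ring

/-- As `|X| = 2 C(d+n, n)`, this determines the trace of the complementary idempotent `L_s`. -/
theorem sum_eval_one_jacobiQ {d : ℕ} (hd : 1 < d) (n : ℕ) :
    ∑ i ∈ Finset.range (n + 1), (jacobiQ 2 d 0 i).eval 1 + (d + n - 1).choose n =
      2 * (d + n).choose n := by
  induction n with
  | zero => simp [eval_one_jacobiQ_zero hd]; norm_num
  | succ n ih =>
    rw [Finset.sum_range_succ, eval_one_jacobiQ_succ hd]
    have h := Nat.choose_succ_succ (d + n) n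
    rw [show d + (n + 1) - 1 = d + n by omega, show d + (n + 1) = (d + n).succ by omega, h]
    push_cast
    linear_combination ih

theorem eval_one_jacobiR_one {d : ℕ} (hd : 1 < d) (n : ℕ) :
    (jacobiR 2 d 1 n).eval 1 = 2 * (d + n).choose n := by
  have hd1 : (1 : ℝ) < d := by exact_mod_cast hd
  have h2 : poch ((d : ℝ) / 2 + 1) n ≠ 0 := (poch_pos (by linarith) _).ne'
  rw [jacobiR_two hd, eval_mul, eval_C, eval_one_jacobiZ_comp, poch_succ_left, poch_succ_left,
    show (d : ℝ) + 1 = (d + 1 : ℕ) by push_cast; rfl, poch_natCast,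
    show d + 1 + n - 1 = d + n by omega]
  generalize poch ((d : ℝ) / 2 + 1) n = P at h2 ⊢
  field_simp

theorem natDegree_jacobiZ_le (a b : ℝ) (n : ℕ) : (jacobiZ a b n).natDegree ≤ n :=
  natDegree_le_iff_coeff_eq_zero.2 fun k hk => by rw [coeff_jacobiZ, jacobiCoeff_of_lt hk]

theorem natDegree_jacobiR_le {d : ℕ} (hd : 1 < d) (ε n : ℕ) :
    (jacobiR 2 d ε n).natDegree ≤ n := by
  rw [jacobiR_two hd]
  refine (natDegree_C_mul_le _ _).trans (natDegree_comp_le.trans ?_)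
  rw [show (X - 1 : ℝ[X]) = X - C 1 by simp, natDegree_X_sub_C, mul_one]
  exact natDegree_jacobiZ_le _ _ _

theorem poch_ratCast (q : ℚ) (n : ℕ) : ∃ r : ℚ, poch (q : ℝ) n = r :=
  ⟨(ascPochhammer ℚ n).eval q, by
    induction n with
    | zero => simp [poch_zero]
    | succ n ih => rw [poch_succ, ascPochhammer_succ_eval, ih]; push_cast; rfl⟩

/-- Rational coefficients make the angles, and then all entries of the `L_i`, algebraic. -/
theorem jacobiQ_mem_lifts (d k : ℕ) : jacobiQ 2 d 0 k ∈ lifts (algebraMap ℚ ℝ) := by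
  have hC : ∀ q : ℚ, C (q : ℝ) ∈ lifts (algebraMap ℚ ℝ) := fun q =>
    (lifts_iff_coeff_lifts _).2 fun n => by
      rw [coeff_C]; split_ifs
      · exact ⟨q, rfl⟩
      · exact ⟨0, by simp⟩
  have hX : (X - 1 : ℝ[X]) ∈ lifts (algebraMap ℚ ℝ) := by
    rw [lifts_iff_ringHom_rangeS]; exact ⟨X - 1, by simp⟩
  obtain ⟨r1, h1⟩ := poch_ratCast d k
  obtain ⟨r2, h2⟩ := poch_ratCast (d / 2) k
  push_cast at h1 h2
  rw [jacobiQ_two, jacobiZ, sum_comp, add_zero, h1, h2]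
  refine mul_mem ?_ (sum_mem fun j _ => ?_)
  · have := hC ((d + 2 * k + (0 : ℕ) - 1) / (d + k + (0 : ℕ) - 1) * (r1 / r2))
    push_cast at this ⊢
    exact this
  · simp only [mul_comp, C_comp, pow_comp, X_comp]
    refine mul_mem ?_ (pow_mem hX _)
    obtain ⟨r3, h3⟩ := poch_ratCast (k + (d / 2 - 1) + (d / 2 - 1 + (0 : ℕ)) + 1) j
    obtain ⟨r4, h4⟩ := poch_ratCast (d / 2 - 1 + j + 1) (k - j)
    push_cast at h3 h4
    rw [jacobiCoeff]
    push_cast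
    rw [h3, h4]
    have := hC (1 / k.factorial * (k.choose j * r3 * r4))
    push_cast at this
    exact this

/-! ### The differential equation of the symmetric Jacobi polynomials -/

theorem coeff_X_mul_derivative (q : ℝ[X]) (k : ℕ) :
    (X * derivative q).coeff k = k * q.coeff k := by
  cases k with
  | zero => simp
  | succ k => rw [coeff_X_mul, coeff_derivative]; push_cast; ring

theorem jacobiCoeff_succ (a b : ℝ) (n k : ℕ) :
    (k + 1) * (a + k + 1) * jacobiCoeff a b n (k + 1) =
      ((n : ℝ) - k) * (n + k + a + b + 1) * jacobiCoeff a b n k := by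
  rcases lt_trichotomy k n with h | rfl | h
  · obtain ⟨m, rfl⟩ := Nat.exists_eq_add_of_le (Nat.succ_le_of_lt h)
    rw [jacobiCoeff_add, show k.succ + m = k + (m + 1) by omega, jacobiCoeff_add, poch_succ,
      poch_succ_left (a + k + 1) m]
    push_cast [Nat.factorial_succ]
    rw [show a + (k + 1) + 1 = a + k + 1 + 1 by ring]
    have h2 : (k.factorial : ℝ) ≠ 0 := by positivity
    have h3 : (m.factorial : ℝ) ≠ 0 := by positivity
    have h4 : (m : ℝ) + 1 ≠ 0 := by positivity
    have h5 : (k : ℝ) + 1 ≠ 0 := by positivity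
    field_simp
    ring
  · rw [jacobiCoeff_of_lt (Nat.lt_succ_self k)]; ring
  · rw [jacobiCoeff_of_lt h, jacobiCoeff_of_lt (by omega)]; ring

/-- In terms of the Euler operator `X * d/dX`, the equation is `jacobiCoeff_succ` read coefficient
by coefficient. -/
theorem jacobiZ_ode (a : ℝ) (n : ℕ) :
    X * (X + 1) * derivative (derivative (jacobiZ a a n)) +
      C (a + 1) * ((1 + 2 * X) * derivative (jacobiZ a a n)) =
      C ((n : ℝ) * (n + 2 * a + 1)) * jacobiZ a a n := by
  set q := jacobiZ a a n with hq
  have e : derivative (X * derivative q) = derivative q + X * derivative (derivative q) := by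
    simp
  have h : X * (X + 1) * derivative (derivative q) + C (a + 1) * ((1 + 2 * X) * derivative q) =
      X * derivative (X * derivative q) + derivative (X * derivative q) +
        C a * derivative q + C (2 * a + 1) * (X * derivative q) := by
    rw [e]; simp only [C_add, C_mul, C_1, show (C 2 : ℝ[X]) = 2 from rfl]; ring
  rw [h]
  ext k
  simp only [coeff_add, coeff_C_mul, coeff_X_mul_derivative, coeff_derivative]
  rw [hq]
  simp only [coeff_jacobiZ]
  have := jacobiCoeff_succ a a n k
  push_cast
  linear_combination this

theorem jacobi_ode (a : ℝ) (n : ℕ) :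
    (X ^ 2 - 1) * derivative (derivative (jacobi a a n)) +
      C (2 * a + 2) * (X * derivative (jacobi a a n)) =
      C ((n : ℝ) * (n + 2 * a + 1)) * jacobi a a n := by
  rw [jacobi_eq_comp]
  set q := jacobiZ a a n with hq
  have h := congrArg (fun p => p.comp (C (1 / 2) * (X - 1))) (jacobiZ_ode a n)
  rw [← hq] at h
  have h2 : (2 : ℝ[X]) = C 2 := rfl
  have h4 : (C (1 / 2) * C 2 : ℝ[X]) = 1 := by rw [← C_mul]; norm_num
  simp only [mul_comp, add_comp, X_comp, C_comp, one_comp, h2] at h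
  simp only [derivative_comp, derivative_mul, derivative_C, derivative_sub, derivative_X,
    derivative_one, zero_mul, sub_zero, mul_one, zero_add]
  rw [← h]
  simp only [C_add, C_mul]
  set Q1 := (derivative q).comp (C (1 / 2) * (X - 1))
  set Q2 := (derivative (derivative q)).comp (C (1 / 2) * (X - 1))
  rw [C_1]
  linear_combination C (1 / 2) ^ 2 * (X - 1) * Q2 * h2 + (C (1 / 2) * (X - 1) * Q2 + C a * X * Q1 + X * Q1
    - (C a + 1) * (X - 1) * Q1) * h4

/-- The Gegenbauer equation in powers of `t`. It yields the parity of the polynomial and is also the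
condition under which `Fischer.zonal` is harmonic. -/
theorem coeff_jacobi_rec (a : ℝ) (n k : ℕ) :
    ((k : ℝ) + 2) * (k + 1) * (jacobi a a n).coeff (k + 2) =
      ((k : ℝ) - n) * (k + n + 2 * a + 1) * (jacobi a a n).coeff k := by
  set p := jacobi a a n with hp
  have e : derivative (X * derivative p) = derivative p + X * derivative (derivative p) := by
    simp
  have h := jacobi_ode a n
  rw [← hp, show (X ^ 2 - 1) * derivative (derivative p) + C (2 * a + 2) * (X * derivative p) =
      X * derivative (X * derivative p) - derivative (derivative p) +
        C (2 * a + 1) * (X * derivative p) by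
    rw [e]; simp only [C_add, C_mul, C_1, show (C 2 : ℝ[X]) = 2 from rfl]; ring] at h
  have hk := congrArg (fun p => p.coeff k) h
  simp only [coeff_add, coeff_sub, coeff_C_mul, coeff_X_mul_derivative, coeff_derivative] at hk
  push_cast at hk
  linear_combination -hk

theorem coeff_jacobi_self (a b : ℝ) (n : ℕ) :
    (jacobi a b n).coeff n = jacobiCoeff a b n n * (1 / 2) ^ n := by
  have hw : (C (1 / 2) * (X - 1) : ℝ[X]) = C (1 / 2) * (X - C 1) := by simp
  have hd : (C (1 / 2) * (X - 1) : ℝ[X]).natDegree = 1 := by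
    rw [hw, natDegree_C_mul (by norm_num), natDegree_X_sub_C]
  have hl : (C (1 / 2) * (X - 1) : ℝ[X]).leadingCoeff = 1 / 2 := by
    rw [hw, leadingCoeff_mul, leadingCoeff_C, leadingCoeff_X_sub_C, mul_one]
  rw [jacobi_eq_comp, jacobiZ, sum_comp, finsetSum_coeff, Finset.sum_range_succ,
    Finset.sum_eq_zero, zero_add]
  · rw [mul_comp, C_comp, pow_comp, X_comp, coeff_C_mul]
    congr 1
    have := coeff_pow_mul_natDegree (C (1 / 2) * (X - 1) : ℝ[X]) n
    rwa [hd, mul_one, hl] at this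
  · intro k hk
    rw [mul_comp, C_comp, pow_comp, X_comp, coeff_C_mul, coeff_eq_zero_of_natDegree_lt, mul_zero]
    rw [natDegree_pow, hd, mul_one]
    exact Finset.mem_range.1 hk

theorem natDegree_jacobi_le (a b : ℝ) (n : ℕ) : (jacobi a b n).natDegree ≤ n := by
  rw [jacobi_eq_comp]
  refine natDegree_comp_le.trans ?_
  have hd : (C (1 / 2) * (X - 1) : ℝ[X]).natDegree = 1 := by
    rw [show (C (1 / 2) * (X - 1) : ℝ[X]) = C (1 / 2) * (X - C 1) by simp,
      natDegree_C_mul (by norm_num), natDegree_X_sub_C]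
  rw [hd, mul_one]
  exact natDegree_jacobiZ_le _ _ _

theorem coeff_jacobi_self_pos {a : ℝ} (ha : 0 ≤ a) (n : ℕ) : 0 < (jacobi a a n).coeff n := by
  rw [coeff_jacobi_self, jacobiCoeff_self]
  have := poch_pos (x := n + a + a + 1) (by positivity) n
  positivity

/-- The symmetric Jacobi polynomial `P_n^{(a,a)}` has the parity of `n`. -/
theorem coeff_jacobi_eq_zero {a : ℝ} (ha : 0 ≤ a) {n j : ℕ} (hj : 2 * j + 1 ≤ n) :
    (jacobi a a n).coeff (n - (2 * j + 1)) = 0 := by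
  -- For `k < n` the factor `(k - n)(k + n + 2a + 1)` is nonzero, so vanishing descends in steps of
  -- two from the coefficient at `n + 1`.
  have key : ∀ k : ℕ, k < n → (jacobi a a n).coeff (k + 2) = 0 → (jacobi a a n).coeff k = 0 := by
    intro k hk h
    have := coeff_jacobi_rec a n k
    rw [h, mul_zero, eq_comm, mul_eq_zero] at this
    refine this.resolve_left (mul_ne_zero ?_ (by positivity))
    have : (k : ℝ) < n := by exact_mod_cast hk
    linarith
  induction j with
  | zero =>
    apply key _ (by omega)
    exact coeff_eq_zero_of_natDegree_lt ((natDegree_jacobi_le _ _ _).trans_lt (by omega))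
  | succ j ih =>
    apply key _ (by omega)
    rw [show n - (2 * (j + 1) + 1) + 2 = n - (2 * j + 1) by omega]
    exact ih (by omega)

theorem eval_jacobi_eq_sum {a : ℝ} (ha : 0 ≤ a) (n : ℕ) (t : ℝ) :
    (jacobi a a n).eval t =
      ∑ j ∈ Finset.range (n / 2 + 1), (jacobi a a n).coeff (n - 2 * j) * t ^ (n - 2 * j) := by
  rw [eval_eq_sum_range' (Nat.lt_succ_of_le (natDegree_jacobi_le a a n))]
  symm
  refine Finset.sum_of_injOn (fun j => n - 2 * j) ?_ ?_ ?_ (fun _ _ => rfl)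
  · intro i hi j hj h
    simp only [Finset.coe_range, Set.mem_Iio] at hi hj
    dsimp only at h
    omega
  · intro i hi
    simp only [Finset.coe_range, Set.mem_Iio] at hi ⊢
    omega
  · intro k hk hk'
    simp only [Finset.mem_range, Finset.coe_range, Set.mem_image, Set.mem_Iio, not_exists,
      not_and] at hk hk'
    have hodd : (n - k) % 2 = 1 := by
      by_contra h
      exact hk' ((n - k) / 2) (by omega) (by omega)
    have := coeff_jacobi_eq_zero ha (n := n) (j := (n - k) / 2) (by omega)
    rw [show n - (2 * ((n - k) / 2) + 1) = k by omega] at this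
    rw [this, zero_mul]

/-! ### The Fischer form on multivariate polynomials -/

namespace Fischer

variable {ι : Type*} [Fintype ι]

/-- The apolar (Fischer) bilinear form, in which the monomials are orthogonal and the monomial
with exponent `m` has square norm `m!`. -/
def form : MvPolynomial ι ℝ →ₗ[ℝ] MvPolynomial ι ℝ →ₗ[ℝ] ℝ :=
  (MvPolynomial.basisMonomials ι ℝ).constr ℝ fun m => ((∏ i, (m i).factorial : ℕ) : ℝ) • MvPolynomial.lcoeff ℝ m

theorem form_monomial (m : ι →₀ ℕ) (q : MvPolynomial ι ℝ) :
    form (MvPolynomial.monomial m 1) q = ((∏ i, (m i).factorial : ℕ) : ℝ) * MvPolynomial.coeff m q := by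
  have := (MvPolynomial.basisMonomials ι ℝ).constr_basis ℝ
    (fun m => ((∏ i, (m i).factorial : ℕ) : ℝ) • MvPolynomial.lcoeff (σ := ι) ℝ m) m
  rw [MvPolynomial.coe_basisMonomials] at this
  rw [form, this]
  rfl

theorem form_self_nonneg (p : MvPolynomial ι ℝ) : 0 ≤ form p p := by
  have h : form p p = ∑ m ∈ p.support, MvPolynomial.coeff m p * form (MvPolynomial.monomial m 1) p := by
    conv_lhs => enter [1]; rw [p.as_sum]
    rw [map_sum, LinearMap.sum_apply]
    refine Finset.sum_congr rfl fun m _ => ?_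
    rw [show MvPolynomial.monomial m (MvPolynomial.coeff m p) = MvPolynomial.coeff m p • MvPolynomial.monomial m (1 : ℝ) by simp [MvPolynomial.smul_monomial],
      map_smul, LinearMap.smul_apply, smul_eq_mul]
  rw [h]
  refine Finset.sum_nonneg fun m _ => ?_
  rw [form_monomial, mul_left_comm]
  exact mul_nonneg (Nat.cast_nonneg _) (mul_self_nonneg _)

/-- On monomials this is `(m + e_i)! = (m_i + 1) m!`. -/
theorem form_X_mul (i : ι) (p q : MvPolynomial ι ℝ) : form (MvPolynomial.X i * p) q = form p (MvPolynomial.pderiv i q) := by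
  classical
  induction p using MvPolynomial.induction_on' with
  | add p₁ p₂ h₁ h₂ => simp only [mul_add, map_add, LinearMap.add_apply, h₁, h₂]
  | monomial m c =>
    rw [show MvPolynomial.monomial m c = c • MvPolynomial.monomial m (1 : ℝ) by simp [MvPolynomial.smul_monomial], mul_smul_comm]
    simp only [map_smul, LinearMap.smul_apply]
    congr 1
    rw [MvPolynomial.X, MvPolynomial.monomial_mul, one_mul, form_monomial, form_monomial, MvPolynomial.coeff_pderiv, add_comm]
    have : ∏ j, ((m + Finsupp.single i 1 : ι →₀ ℕ) j).factorial = (m i + 1) * ∏ j, (m j).factorial := by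
      rw [← Finset.mul_prod_erase _ _ (Finset.mem_univ i),
        ← Finset.mul_prod_erase (a := i) Finset.univ (fun j => (m j).factorial)
          (Finset.mem_univ i), ← mul_assoc]
      congr 1
      · simp [Nat.factorial_succ]
      · refine Finset.prod_congr rfl fun j hj => ?_
        simp [Finsupp.single_eq_of_ne (Finset.ne_of_mem_erase hj)]
    rw [this]
    push_cast
    ring

/-- The linear form `x ↦ u · x`. -/
def lin (u : ι → ℝ) : MvPolynomial ι ℝ := ∑ i, MvPolynomial.C (u i) * MvPolynomial.X i

/-- The quadratic form `x ↦ x · x`. -/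
def quad : MvPolynomial ι ℝ := ∑ i, MvPolynomial.X i ^ 2

/-- The Laplace operator. -/
def laplace (p : MvPolynomial ι ℝ) : MvPolynomial ι ℝ := ∑ i, MvPolynomial.pderiv i (MvPolynomial.pderiv i p)

theorem form_lin_mul (u : ι → ℝ) (p q : MvPolynomial ι ℝ) :
    form (lin u * p) q = ∑ i, u i * form p (MvPolynomial.pderiv i q) := by
  rw [lin, Finset.sum_mul, map_sum, LinearMap.sum_apply]
  refine Finset.sum_congr rfl fun i _ => ?_
  rw [mul_assoc, MvPolynomial.C_mul', map_smul, LinearMap.smul_apply, form_X_mul, smul_eq_mul]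

/-- By this adjointness, multiples of `quad` are orthogonal to harmonic polynomials. -/
theorem form_quad_mul (p q : MvPolynomial ι ℝ) : form (quad * p) q = form p (laplace q) := by
  rw [quad, Finset.sum_mul, map_sum, LinearMap.sum_apply, laplace, map_sum]
  refine Finset.sum_congr rfl fun i _ => ?_
  rw [pow_two, mul_assoc, form_X_mul, form_X_mul]

/-- Each linear factor moves across as a directional derivative, and Euler's identity at `u`
contributes one factor of the factorial. -/
theorem form_lin_pow (u : ι → ℝ) (n : ℕ) (q : MvPolynomial ι ℝ) (hq : q.IsHomogeneous n) :
    form (lin u ^ n) q = n.factorial * MvPolynomial.eval u q := by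
  induction n generalizing q with
  | zero =>
    rw [pow_zero, show (1 : MvPolynomial ι ℝ) = MvPolynomial.monomial 0 1 from rfl, form_monomial]
    rw [← MvPolynomial.totalDegree_zero_iff_isHomogeneous, MvPolynomial.totalDegree_eq_zero_iff_eq_C] at hq
    rw [hq]
    simp
  | succ n ih =>
    rw [pow_succ', form_lin_mul]
    have he := congrArg (MvPolynomial.eval u) hq.sum_X_mul_pderiv
    simp only [map_sum, map_mul, MvPolynomial.eval_X, nsmul_eq_mul, map_natCast] at he
    rw [Finset.sum_congr rfl fun i _ => by rw [ih (MvPolynomial.pderiv i q) hq.pderiv], Nat.factorial_succ]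
    rw [Nat.cast_mul, mul_comm ((n + 1 : ℕ) : ℝ), mul_assoc, ← he, Finset.mul_sum]
    exact Finset.sum_congr rfl fun i _ => by ring

theorem pderiv_lin (u : ι → ℝ) (i : ι) : MvPolynomial.pderiv i (lin u) = MvPolynomial.C (u i) := by
  classical
  simp only [lin, map_sum, MvPolynomial.pderiv_C_mul, MvPolynomial.pderiv_X]
  simp [Pi.single_apply]

theorem pderiv_quad (i : ι) : MvPolynomial.pderiv i (quad : MvPolynomial ι ℝ) = 2 * MvPolynomial.X i := by
  classical
  simp only [quad, map_sum, MvPolynomial.pderiv_pow, MvPolynomial.pderiv_X]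
  simp [Pi.single_apply]

theorem laplace_C_mul (c : ℝ) (p : MvPolynomial ι ℝ) : laplace (MvPolynomial.C c * p) = MvPolynomial.C c * laplace p := by
  simp only [laplace, MvPolynomial.pderiv_C_mul, Finset.mul_sum]

/-- The exponents `m - 2` and `j - 1` are truncated only for `m ≤ 1` and `j = 0`, where their
coefficients vanish. -/
theorem laplace_lin_pow_mul_quad_pow {u : ι → ℝ} (hu : ∑ i, u i ^ 2 = 1) (m j : ℕ) :
    laplace (lin u ^ m * quad ^ j) =
      MvPolynomial.C ((m : ℝ) * (m - 1)) * (lin u ^ (m - 2) * quad ^ j) +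
      MvPolynomial.C ((2 : ℝ) * j * (2 * m + Fintype.card ι + 2 * j - 2)) *
        (lin u ^ m * quad ^ (j - 1)) := by
  have h1 : ∀ i, MvPolynomial.pderiv i (MvPolynomial.pderiv i (lin u ^ m * quad ^ j)) =
      MvPolynomial.C ((m : ℝ) * (m - 1)) * (lin u ^ (m - 2) * quad ^ j) * MvPolynomial.C (u i ^ 2) +
      MvPolynomial.C ((4 : ℝ) * m * j) * (lin u ^ (m - 1) * quad ^ (j - 1)) * (MvPolynomial.C (u i) * MvPolynomial.X i) +
      MvPolynomial.C ((2 : ℝ) * j) * (lin u ^ m * quad ^ (j - 1)) +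
      MvPolynomial.C ((4 : ℝ) * j * (j - 1)) * (lin u ^ m * quad ^ (j - 2)) * MvPolynomial.X i ^ 2 := by
    intro i
    have hm : ((m - 1 : ℕ) : ℝ) * m = m * (m - 1) := by
      cases m <;> simp [mul_comm]
    have hj : ((j - 1 : ℕ) : ℝ) * j = j * (j - 1) := by
      cases j <;> simp [mul_comm]
    have hm' := congrArg (MvPolynomial.C : ℝ → MvPolynomial ι ℝ) hm
    have hj' := congrArg (MvPolynomial.C : ℝ → MvPolynomial ι ℝ) hj
    have h2 : (MvPolynomial.C 2 : MvPolynomial ι ℝ) = 2 := rfl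
    have h4 : (MvPolynomial.C 4 : MvPolynomial ι ℝ) = 4 := rfl
    have hn : ∀ k : ℕ, (MvPolynomial.C (k : ℝ) : MvPolynomial ι ℝ) = k := fun k => by simp
    have d2 : MvPolynomial.pderiv i (2 : MvPolynomial ι ℝ) = 0 := by rw [← h2, MvPolynomial.pderiv_C]
    have dn : ∀ k : ℕ, MvPolynomial.pderiv i (k : MvPolynomial ι ℝ) = 0 := fun k => by rw [← hn, MvPolynomial.pderiv_C]
    simp only [MvPolynomial.pderiv_mul, MvPolynomial.pderiv_pow, pderiv_lin, pderiv_quad, map_add, MvPolynomial.pderiv_C,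
      MvPolynomial.pderiv_X_self, Nat.sub_sub, d2, dn]
    simp only [MvPolynomial.C_mul, MvPolynomial.C_sub, MvPolynomial.C_1, MvPolynomial.C_pow, h2, h4, hn, one_add_one_eq_two] at hm' hj' ⊢
    linear_combination (MvPolynomial.C (u i) ^ 2 * lin u ^ (m - 2) * quad ^ j) * hm' +
      (4 * MvPolynomial.X i ^ 2 * lin u ^ m * quad ^ (j - 2)) * hj'
  rw [laplace, Finset.sum_congr rfl fun i _ => h1 i]
  simp only [Finset.sum_add_distrib, ← Finset.mul_sum]
  rw [← map_sum, hu, MvPolynomial.C_1, Finset.sum_const, Finset.card_univ, ← lin, ← quad]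
  have hm : (MvPolynomial.C ((4 : ℝ) * m * j) * (lin u ^ (m - 1) * quad ^ (j - 1)) * lin u : MvPolynomial ι ℝ) =
      MvPolynomial.C ((4 : ℝ) * m * j) * (lin u ^ m * quad ^ (j - 1)) := by
    cases m with
    | zero => simp
    | succ m => rw [Nat.add_sub_cancel, pow_succ]; ring
  have hj : (MvPolynomial.C ((4 : ℝ) * j * (j - 1)) * (lin u ^ m * quad ^ (j - 2)) * quad : MvPolynomial ι ℝ) =
      MvPolynomial.C ((4 : ℝ) * j * (j - 1)) * (lin u ^ m * quad ^ (j - 1)) := by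
    match j with
    | 0 => simp
    | 1 => simp
    | j + 2 => rw [Nat.add_sub_cancel, show j + 2 - 1 = j + 1 by omega, pow_succ quad j]; ring
  rw [hm, hj, nsmul_eq_mul, ← MvPolynomial.C_eq_coe_nat]
  simp only [MvPolynomial.C_mul, MvPolynomial.C_sub, MvPolynomial.C_add]
  have h2 : (MvPolynomial.C 2 : MvPolynomial ι ℝ) = 2 := rfl
  have h4 : (MvPolynomial.C 4 : MvPolynomial ι ℝ) = 4 := rfl
  rw [h2, h4, MvPolynomial.C_1]
  ring

theorem isHomogeneous_lin (u : ι → ℝ) : (lin u).IsHomogeneous 1 :=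
  MvPolynomial.IsHomogeneous.sum _ _ _ fun i _ => by
    simpa using (MvPolynomial.isHomogeneous_C ι (u i)).mul (MvPolynomial.isHomogeneous_X ℝ i)

theorem isHomogeneous_quad : (quad : MvPolynomial ι ℝ).IsHomogeneous 2 :=
  MvPolynomial.IsHomogeneous.sum _ _ _ fun i _ => by simpa using (MvPolynomial.isHomogeneous_X ℝ i).pow 2

theorem eval_lin (u v : ι → ℝ) : MvPolynomial.eval v (lin u) = ∑ i, u i * v i := by simp [lin]

theorem eval_quad (v : ι → ℝ) : MvPolynomial.eval v (quad : MvPolynomial ι ℝ) = ∑ i, v i ^ 2 := by simp [quad]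

/-- The homogeneous polynomial `∑_j c_{n-2j} (u · x)^{n-2j} (x · x)^j`, where `c_k` are the
coefficients of `p`. -/
def zonal (p : ℝ[X]) (n : ℕ) (u : ι → ℝ) : MvPolynomial ι ℝ :=
  ∑ j ∈ Finset.range (n / 2 + 1), MvPolynomial.C (p.coeff (n - 2 * j)) * (lin u ^ (n - 2 * j) * quad ^ j)

theorem isHomogeneous_zonal (p : ℝ[X]) (n : ℕ) (u : ι → ℝ) : (zonal p n u).IsHomogeneous n :=
  MvPolynomial.IsHomogeneous.sum _ _ _ fun j hj => by
    have h := (MvPolynomial.isHomogeneous_C ι (p.coeff (n - 2 * j))).mul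
      (((isHomogeneous_lin u).pow (n - 2 * j)).mul ((isHomogeneous_quad (ι := ι)).pow j))
    have hj' := Finset.mem_range.1 hj
    rwa [show 0 + (1 * (n - 2 * j) + 2 * j) = n by omega] at h

/-- The Laplacian of a partial sum leaves a single term, which `hp` cancels against the next
summand. The last leftover carries the factor `k (k - 1)` with `k ∈ {0, 1}`. -/
theorem laplace_zonal {p : ℝ[X]} {n : ℕ}
    (hp : ∀ k : ℕ, ((k : ℝ) + 2) * (k + 1) * p.coeff (k + 2) =
      ((k : ℝ) - n) * (k + n + Fintype.card ι - 2) * p.coeff k)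
    {u : ι → ℝ} (hu : ∑ i, u i ^ 2 = 1) : laplace (zonal p n u) = 0 := by
  have key : ∀ J : ℕ, 2 * J ≤ n →
      laplace (∑ j ∈ Finset.range (J + 1), MvPolynomial.C (p.coeff (n - 2 * j)) *
        (lin u ^ (n - 2 * j) * quad ^ j)) =
      MvPolynomial.C (p.coeff (n - 2 * J) * ((n - 2 * J : ℕ) * ((n - 2 * J : ℕ) - 1))) *
        (lin u ^ (n - 2 * J - 2) * quad ^ J) := by
    intro J
    induction J with
    | zero =>
      intro _
      rw [zero_add, Finset.sum_range_one, laplace_C_mul, laplace_lin_pow_mul_quad_pow hu]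
      simp only [Nat.cast_zero, mul_zero, zero_mul, MvPolynomial.C_0, add_zero, MvPolynomial.C_mul]
      ring
    | succ J ih =>
      intro hJ
      rw [Finset.sum_range_succ, laplace, ]
      simp only [map_add, Finset.sum_add_distrib]
      rw [← laplace, ← laplace, ih (by omega), laplace_C_mul, laplace_lin_pow_mul_quad_pow hu,
        show n - 2 * J - 2 = n - 2 * (J + 1) by omega, Nat.add_sub_cancel]
      obtain ⟨k, hk⟩ : ∃ k, n = k + 2 * (J + 1) := ⟨n - 2 * (J + 1), by omega⟩
      have hk' := hp k
      rw [show n - 2 * (J + 1) = k by omega, show n - 2 * J = k + 2 by omega]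
      have hnR : (n : ℝ) = k + 2 * (J + 1) := by exact_mod_cast hk
      rw [hnR] at hk'
      have hc : p.coeff (k + 2) * ((k + 2 : ℕ) * ((k + 2 : ℕ) - 1)) + p.coeff k *
          (2 * ((J + 1 : ℕ) : ℝ) * (2 * k + Fintype.card ι + 2 * (J + 1 : ℕ) - 2)) = 0 := by
        push_cast
        linear_combination hk'
      have hc' := congrArg (MvPolynomial.C : ℝ → MvPolynomial ι ℝ) hc
      rw [MvPolynomial.C_0, MvPolynomial.C_add, MvPolynomial.C_mul, MvPolynomial.C_mul (a := p.coeff k)] at hc'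
      rw [MvPolynomial.C_mul, MvPolynomial.C_mul (a := p.coeff k)]
      linear_combination (lin u ^ k * quad ^ J) * hc'
  rw [zonal, key _ (by omega)]
  have h01 : n - 2 * (n / 2) = 0 ∨ n - 2 * (n / 2) = 1 := by omega
  rcases h01 with h | h <;> simp [h]

theorem eval_zonal (p : ℝ[X]) (n : ℕ) (u : ι → ℝ) {v : ι → ℝ} (hv : ∑ i, v i ^ 2 = 1) :
    MvPolynomial.eval v (zonal p n u) =
      ∑ j ∈ Finset.range (n / 2 + 1), p.coeff (n - 2 * j) * (∑ i, u i * v i) ^ (n - 2 * j) := by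
  simp [zonal, eval_lin, eval_quad, hv]

/-- The reproducing property of zonal harmonics. -/
theorem form_zonal {p : ℝ[X]} {n : ℕ}
    (hp : ∀ k : ℕ, ((k : ℝ) + 2) * (k + 1) * p.coeff (k + 2) =
      ((k : ℝ) - n) * (k + n + Fintype.card ι - 2) * p.coeff k)
    (u : ι → ℝ) {v : ι → ℝ} (hv : ∑ i, v i ^ 2 = 1) :
    form (zonal p n u) (zonal p n v) = p.coeff n * (n.factorial * MvPolynomial.eval u (zonal p n v)) := by
  conv_lhs => rw [zonal]
  -- Summands with `j ≥ 1` contain `quad` and pair to zero with the harmonic `zonal p n v`; only the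
  -- pure power of `lin u` survives, and it evaluates at `u`.
  rw [map_sum, LinearMap.sum_apply, Finset.sum_range_succ', Finset.sum_eq_zero, zero_add]
  · rw [mul_zero, Nat.sub_zero, pow_zero, mul_one, MvPolynomial.C_mul', map_smul, LinearMap.smul_apply,
      form_lin_pow u n _ (isHomogeneous_zonal p n v), smul_eq_mul]
  · intro j _
    rw [pow_succ', mul_left_comm _ quad, mul_left_comm _ quad, form_quad_mul, laplace_zonal hp hv,
      map_zero]

end Fischer

/-! ### Zonal kernels on the sphere -/

section Zonal

variable {d : ℕ} {κ : Type*} [Fintype κ]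

theorem sum_sq_of_norm_eq_one {v : EuclideanSpace ℝ (Fin d)} (hv : ‖v‖ = 1) :
    ∑ i, v i ^ 2 = 1 := by
  have h := EuclideanSpace.norm_sq_eq v
  rw [hv] at h
  simpa using h.symm

theorem sum_mul_eq_inner (u v : EuclideanSpace ℝ (Fin d)) : ∑ i, u i * v i = inner ℝ u v := by
  simp [PiLp.inner_apply, mul_comm]

theorem coeff_jacobi_laplace (d n k : ℕ) :
    ((k : ℝ) + 2) * (k + 1) * (jacobi ((d : ℝ) / 2 - 1) (d / 2 - 1) n).coeff (k + 2) =
      ((k : ℝ) - n) * (k + n + Fintype.card (Fin (d + 1)) - 2) *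
        (jacobi ((d : ℝ) / 2 - 1) (d / 2 - 1) n).coeff k := by
  rw [coeff_jacobi_rec, Fintype.card_fin]
  push_cast
  ring

theorem half_sub_one_nonneg {d : ℕ} (hd : 1 < d) : (0 : ℝ) ≤ d / 2 - 1 := by
  have : (2 : ℝ) ≤ d := by exact_mod_cast hd
  linarith

theorem eval_zonal_jacobi (hd : 1 < d) (n : ℕ) {u v : EuclideanSpace ℝ (Fin (d + 1))}
    (hu : ‖u‖ = 1) :
    MvPolynomial.eval u (Fischer.zonal (jacobi ((d : ℝ) / 2 - 1) (d / 2 - 1) n) n v) =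
      (jacobi ((d : ℝ) / 2 - 1) (d / 2 - 1) n).eval (inner ℝ u v) := by
  rw [Fischer.eval_zonal _ _ _ (sum_sq_of_norm_eq_one hu),
    eval_jacobi_eq_sum (half_sub_one_nonneg hd), sum_mul_eq_inner, real_inner_comm]

/-- Schoenberg's theorem: Gegenbauer polynomials of inner products are positive semidefinite. -/
theorem posSemidef_jacobi_inner (hd : 1 < d) (n : ℕ) {u : κ → EuclideanSpace ℝ (Fin (d + 1))}
    (hu : ∀ i, ‖u i‖ = 1) :
    (Matrix.of fun i j => (jacobi ((d : ℝ) / 2 - 1) (d / 2 - 1) n).eval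
      (inner ℝ (u i) (u j))).PosSemidef := by
  set p := jacobi ((d : ℝ) / 2 - 1) (d / 2 - 1) n with hp
  have hc : 0 < p.coeff n := coeff_jacobi_self_pos (half_sub_one_nonneg hd) n
  have hn : (0 : ℝ) < n.factorial := by positivity
  -- The kernel is a positive multiple of the Gram matrix of the zonal polynomials for the Fischer
  -- form.
  have key : ∀ i j, p.eval (inner ℝ (u i) (u j)) = (p.coeff n * n.factorial)⁻¹ *
      Fischer.form (Fischer.zonal p n (u i)) (Fischer.zonal p n (u j)) := by
    intro i j
    rw [Fischer.form_zonal (coeff_jacobi_laplace d n) _ (sum_sq_of_norm_eq_one (hu j)),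
      eval_zonal_jacobi hd n (hu i), ← hp]
    field_simp
  refine Matrix.PosSemidef.of_dotProduct_mulVec_nonneg ?_ fun x => ?_
  · ext i j
    simp [Matrix.conjTranspose_apply, real_inner_comm]
  · have : dotProduct (star x) (Matrix.mulVec (Matrix.of fun i j => p.eval (inner ℝ (u i) (u j))) x) =
        (p.coeff n * n.factorial)⁻¹ * Fischer.form (∑ i, x i • Fischer.zonal p n (u i))
          (∑ i, x i • Fischer.zonal p n (u i)) := by
      simp only [dotProduct, Matrix.mulVec, Matrix.of_apply, Pi.star_apply, star_trivial, key,
        map_sum, LinearMap.sum_apply, map_smul, LinearMap.smul_apply, smul_eq_mul, Finset.mul_sum]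
      rw [Finset.sum_comm]
      exact Finset.sum_congr rfl fun i _ => Finset.sum_congr rfl fun j _ => by ring
    rw [this]
    exact mul_nonneg (by positivity) (Fischer.form_self_nonneg _)

/-- `f ⟨u, v⟩` is, on the unit sphere, a homogeneous polynomial of degree `n` in `u`. -/
def IsZonalOfDegree (d n : ℕ) (f : ℝ → ℝ) : Prop :=
  ∀ v : EuclideanSpace ℝ (Fin (d + 1)), ‖v‖ = 1 →
    ∃ F : MvPolynomial (Fin (d + 1)) ℝ, F.IsHomogeneous n ∧
      ∀ u : EuclideanSpace ℝ (Fin (d + 1)), ‖u‖ = 1 → MvPolynomial.eval u F = f (inner ℝ u v)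

theorem IsZonalOfDegree.add {n : ℕ} {f g : ℝ → ℝ} (hf : IsZonalOfDegree d n f)
    (hg : IsZonalOfDegree d n g) : IsZonalOfDegree d n (fun t => f t + g t) := by
  intro v hv
  obtain ⟨F, hF, hF'⟩ := hf v hv
  obtain ⟨G, hG, hG'⟩ := hg v hv
  exact ⟨F + G, hF.add hG, fun u hu => by rw [map_add, hF' u hu, hG' u hu]⟩

theorem IsZonalOfDegree.const_mul {n : ℕ} {f : ℝ → ℝ} (hf : IsZonalOfDegree d n f) (c : ℝ) :
    IsZonalOfDegree d n (fun t => c * f t) := by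
  intro v hv
  obtain ⟨F, hF, hF'⟩ := hf v hv
  refine ⟨MvPolynomial.C c * F, ?_, fun u hu => by
    rw [map_mul, MvPolynomial.eval_C, hF' u hu]⟩
  simpa using (MvPolynomial.isHomogeneous_C (Fin (d + 1)) c).mul hF

/-- Multiplying by `x · x`, which is `1` on the sphere, lets terms of equal parity share one degree.
-/
theorem IsZonalOfDegree.add_two {n : ℕ} {f : ℝ → ℝ} (hf : IsZonalOfDegree d n f) :
    IsZonalOfDegree d (n + 2) f := by
  intro v hv
  obtain ⟨F, hF, hF'⟩ := hf v hv
  refine ⟨F * Fischer.quad, hF.mul Fischer.isHomogeneous_quad, fun u hu => ?_⟩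
  rw [map_mul, hF' u hu, Fischer.eval_quad, sum_sq_of_norm_eq_one hu, mul_one]

theorem isZonalOfDegree_jacobi (hd : 1 < d) (n : ℕ) :
    IsZonalOfDegree d n fun t => (jacobi ((d : ℝ) / 2 - 1) (d / 2 - 1) n).eval t :=
  fun v _ => ⟨_, Fischer.isHomogeneous_zonal _ n v, fun _ hu => eval_zonal_jacobi hd n hu⟩

/-- The matrix factors through the `C(d+n, n)` monomials of degree `n` in `d + 1` variables. -/
theorem IsZonalOfDegree.rank_le {n : ℕ} {f : ℝ → ℝ} (hf : IsZonalOfDegree d n f)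
    {u : κ → EuclideanSpace ℝ (Fin (d + 1))} (hu : ∀ i, ‖u i‖ = 1) :
    (Matrix.of fun i j => f (inner ℝ (u i) (u j))).rank ≤ (d + n).choose n := by
  choose F hF hF' using fun j => hf (u j) (hu j)
  let S := (Finset.univ : Finset (Fin (d + 1))).finsuppAntidiag n
  have hS : S.card = (d + n).choose n := by
    rw [Finset.card_finsuppAntidiag_nat_eq_choose, Finset.card_univ, Fintype.card_fin,
      show d + 1 + n - 1 = d + n by omega]
  have h : (Matrix.of fun i j => f (inner ℝ (u i) (u j))) =
      (Matrix.of fun i (m : S) => ∏ k, u i k ^ (m : Fin (d + 1) →₀ ℕ) k) *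
        Matrix.of fun (m : S) j => MvPolynomial.coeff (m : Fin (d + 1) →₀ ℕ) (F j) := by
    ext i j
    rw [Matrix.mul_apply, Matrix.of_apply, ← hF' j (u i) (hu i), MvPolynomial.eval_eq']
    simp only [Matrix.of_apply]
    rw [Finset.sum_coe_sort S fun m => (∏ k, u i k ^ m k) * MvPolynomial.coeff m (F j)]
    have hsub : (F j).support ⊆ S := by
      intro m hm
      rw [Finset.mem_finsuppAntidiag]
      refine ⟨?_, Finset.subset_univ _⟩
      have := hF j (MvPolynomial.mem_support_iff.1 hm)
      rw [Finsupp.weight_apply, Finsupp.sum_fintype _ _ (by simp)] at this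
      simpa using this
    rw [Finset.sum_subset hsub]
    · exact Finset.sum_congr rfl fun m _ => mul_comm _ _
    · intro m _ hm
      rw [MvPolynomial.notMem_support_iff.1 hm, zero_mul]
  rw [h, ← hS]
  refine (Matrix.rank_mul_le_left _ _).trans ?_
  simpa using Matrix.rank_le_card_width
    (Matrix.of fun i (m : S) => ∏ k, u i k ^ (m : Fin (d + 1) →₀ ℕ) k)

end Zonal

/-! ### Positive semidefinite matrices and projections -/

namespace Matrix

variable {n : Type*} [Fintype n] [DecidableEq n]

theorem PosSemidef.eigenvalues_le_one {A : Matrix n n ℝ} (hA : A.PosSemidef)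
    (h1 : (1 - A).PosSemidef) (i : n) : hA.1.eigenvalues i ≤ 1 := by
  have hv := h1.dotProduct_mulVec_nonneg (hA.1.eigenvectorBasis i : n → ℝ)
  have he := hA.1.eigenvalues_eq i
  have hn : star (hA.1.eigenvectorBasis i : n → ℝ) ⬝ᵥ (hA.1.eigenvectorBasis i : n → ℝ) = 1 := by
    have h := hA.1.eigenvectorBasis.orthonormal.1 i
    have h2 := EuclideanSpace.norm_sq_eq (hA.1.eigenvectorBasis i)
    rw [h] at h2
    simpa [dotProduct, pow_two] using h2.symm
  rw [sub_mulVec, one_mulVec, dotProduct_sub, hn] at hv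
  simp only [RCLike.re_to_real] at he
  rw [he]
  linarith

/-- The eigenvalues lie in `[0, 1]`, so the trace is at most the number of nonzero ones. Equality
forces each eigenvalue to be `0` or `1`. -/
theorem PosSemidef.isIdempotentElem_of_rank_le_trace {A : Matrix n n ℝ} (hA : A.PosSemidef)
    (h1 : (1 - A).PosSemidef) (hr : (A.rank : ℝ) ≤ A.trace) : A * A = A := by
  have h01 : ∀ i, hA.1.eigenvalues i = 0 ∨ hA.1.eigenvalues i = 1 := by
    have ht : A.trace = ∑ i, hA.1.eigenvalues i := by
      simpa using hA.1.trace_eq_sum_eigenvalues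
    have hc : (A.rank : ℝ) = ∑ i, if hA.1.eigenvalues i ≠ 0 then (1 : ℝ) else 0 := by
      rw [hA.1.rank_eq_card_non_zero_eigs, Fintype.card_subtype, Finset.sum_boole]
    have hle : ∀ i ∈ Finset.univ, hA.1.eigenvalues i ≤
        if hA.1.eigenvalues i ≠ 0 then (1 : ℝ) else 0 := by
      intro i _
      split_ifs with h
      · exact hA.eigenvalues_le_one h1 i
      · exact (not_not.1 h).le
    have heq := (Finset.sum_eq_sum_iff_of_le hle).1
      (le_antisymm (Finset.sum_le_sum hle) (by rw [← hc, ← ht]; exact hr))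
    intro i
    have := heq i (Finset.mem_univ i)
    by_cases h : hA.1.eigenvalues i = 0
    · exact Or.inl h
    · rw [if_pos h] at this; exact Or.inr this
  have hs := hA.1.spectral_theorem
  have hd : diagonal (RCLike.ofReal ∘ hA.1.eigenvalues : n → ℝ) *
      diagonal (RCLike.ofReal ∘ hA.1.eigenvalues) =
      diagonal (RCLike.ofReal ∘ hA.1.eigenvalues : n → ℝ) := by
    rw [diagonal_mul_diagonal]
    congr 1
    ext i
    rcases h01 i with h | h <;> simp [h]
  rw [hs, ← map_mul, hd]

/-- Compressing `1 - P - Q` by `P` gives `-(QP)ᴴ(QP)`, which is positive semidefinite only if `QP =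
0`. -/
theorem PosSemidef.mul_eq_zero_of_add_le_one {P Q : Matrix n n ℝ} (hP : P.PosSemidef)
    (hQ : Q.PosSemidef) (hPP : P * P = P) (hQQ : Q * Q = Q) (h : (1 - P - Q).PosSemidef) :
    P * Q = 0 := by
  have hPh : Pᴴ = P := hP.1
  have hQh : Qᴴ = Q := hQ.1
  have h1 := h.conjTranspose_mul_mul_same P
  have h2 : Pᴴ * (1 - P - Q) * P = -((Q * P)ᴴ * (Q * P)) := by
    rw [conjTranspose_mul, hPh, hQh]
    have e : P * Q * (Q * P) = P * Q * P := by
      rw [mul_assoc, ← mul_assoc Q, hQQ, mul_assoc]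
    rw [e, mul_sub, mul_sub, mul_one, hPP, sub_self, zero_sub, neg_mul]
  rw [h2] at h1
  have h3 := (posSemidef_conjTranspose_mul_self (Q * P)).trace_nonneg
  have h4 := h1.trace_nonneg
  rw [trace_neg] at h4
  have h5 := trace_conjTranspose_mul_self_eq_zero_iff.1 (le_antisymm (by linarith) h3)
  have h6 := congrArg Matrix.conjTranspose h5
  rwa [conjTranspose_mul, hPh, hQh, conjTranspose_zero] at h6

/-- The difference of two nested projections is a projection. -/
theorem PosSemidef.sub_isIdempotentElem {P Q : Matrix n n ℝ} (hP : P.PosSemidef)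
    (hQ : Q.PosSemidef) (hPP : P * P = P) (hQQ : Q * Q = Q) (h : (P - Q).PosSemidef) :
    (P - Q) * (P - Q) = P - Q := by
  have h1P : ((1 - P) * (1 - P)) = 1 - P := by
    rw [sub_mul, mul_sub, mul_sub, one_mul, mul_one, hPP, one_mul, sub_self, sub_zero]
  have hps : (1 - P).PosSemidef := by
    have := posSemidef_conjTranspose_mul_self (1 - P)
    rwa [conjTranspose_sub, conjTranspose_one, show Pᴴ = P from hP.1, h1P] at this
  -- The condition `Q ≤ P` reads `(1 - P) + Q ≤ 1`, so the projections `1 - P` and `Q` are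
  -- orthogonal.
  have h2 : (1 - P) * Q = 0 :=
    hps.mul_eq_zero_of_add_le_one hQ h1P hQQ (by rwa [sub_sub_cancel])
  have hPQ : P * Q = Q := by
    rw [sub_mul, one_mul, sub_eq_zero] at h2; exact h2.symm
  have hQP : Q * P = Q := by
    have := congrArg Matrix.conjTranspose hPQ
    rwa [conjTranspose_mul, show Pᴴ = P from hP.1, show Qᴴ = Q from hQ.1] at this
  rw [sub_mul, mul_sub, mul_sub, hPP, hPQ, hQP, hQQ, sub_self, sub_zero]

theorem rank_eq_trace_of_isIdempotentElem {K : Type*} [Field K] {A : Matrix n n K}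
    (h : A * A = A) : (A.rank : K) = A.trace := by
  have hf : IsIdempotentElem (Matrix.toLin' A) := by
    have := Matrix.toLin'_mul A A
    rw [h] at this
    exact this.symm
  rw [← Matrix.trace_toLin'_eq, (LinearMap.IsIdempotentElem.isProj_range _ hf).trace, Matrix.rank, Matrix.toLin'_apply']

end Matrix

/-! ### Primitive idempotents and the unit sphere -/

namespace SpinFactor

variable {d : ℕ}

/-- A nonzero vector part `u` satisfies `2a u = u`, so `a = 1/2`, and the scalar equation then fixes
its length. -/
theorem isIdem_cases {c : SpinFactor d} (hc : IsIdem c) :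
    c = 0 ∨ c = (1, 0) ∨ ∃ u, ‖u‖ = 1 ∧ c = ofSphere u := by
  have h1 : c.1 * c.1 + inner ℝ c.2 c.2 = c.1 := congrArg Prod.fst hc
  have h2 : c.1 • c.2 + c.1 • c.2 = c.2 := congrArg Prod.snd hc
  by_cases hu : c.2 = 0
  · rw [hu, inner_zero_left, add_zero] at h1
    have : c.1 * (c.1 - 1) = 0 := by linarith
    rcases mul_eq_zero.1 this with h | h
    · exact Or.inl (Prod.ext h hu)
    · exact Or.inr (Or.inl (Prod.ext (by dsimp only; linarith) hu))
  · have h3 : (2 * c.1 - 1) • c.2 = 0 := by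
      rw [sub_smul, mul_smul, two_smul, h2, one_smul, sub_self]
    have h4 : c.1 = 1 / 2 := by
      have := (smul_eq_zero.1 h3).resolve_right hu
      linarith
    refine Or.inr (Or.inr ⟨(2 : ℝ) • c.2, ?_, Prod.ext h4 ?_⟩)
    · rw [h4, real_inner_self_eq_norm_sq] at h1
      have h5 : (2 * ‖c.2‖) ^ 2 = 1 := by linarith
      rw [norm_smul, Real.norm_eq_abs, abs_two]
      exact (pow_eq_one_iff_of_nonneg (by positivity) two_ne_zero).1 h5
    · simp [ofSphere, smul_smul]

theorem isIdem_ofSphere {u : EuclideanSpace ℝ (Fin (d + 1))} (hu : ‖u‖ = 1) :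
    IsIdem (ofSphere u) := by
  refine Prod.ext ?_ ?_
  · simp only [ofSphere, jmul, real_inner_self_eq_norm_sq, norm_smul, hu]
    norm_num
  · simp only [ofSphere, jmul]
    module

theorem isPrimitiveIdem_iff {c : SpinFactor d} :
    IsPrimitiveIdem c ↔ ∃ u, ‖u‖ = 1 ∧ c = ofSphere u := by
  constructor
  · rintro ⟨h1, h2, h3⟩
    rcases isIdem_cases h1 with h | rfl | h
    · exact absurd h h2
    -- The unit `(1, 0)` is not primitive: it is the sum of the orthogonal idempotents of two
    -- antipodal points.
    · let e : EuclideanSpace ℝ (Fin (d + 1)) := EuclideanSpace.single 0 1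
      have he : ‖e‖ = 1 := by simp [e]
      have he' : ‖-e‖ = 1 := by simp [e]
      refine absurd ⟨ofSphere e, ofSphere (-e), isIdem_ofSphere he, isIdem_ofSphere he', ?_, ?_,
        Prod.ext ?_ ?_, Prod.ext ?_ ?_⟩ h3
      · intro h; simpa [ofSphere] using congrArg Prod.fst h
      · intro h; simpa [ofSphere] using congrArg Prod.fst h
      · simp only [ofSphere, jmul, real_inner_smul_left, real_inner_smul_right, inner_neg_right,
          real_inner_self_eq_norm_sq, he]
        norm_num
      · simp [ofSphere, jmul]
      · simp [ofSphere]; norm_num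
      · simp [ofSphere]
    · exact h
  · rintro ⟨u, hu, rfl⟩
    refine ⟨isIdem_ofSphere hu, ?_, ?_⟩
    · intro h; simpa [ofSphere] using congrArg Prod.fst h
    · rintro ⟨a, b, ha, hb, ha0, hb0, -, hab⟩
      -- Two nonzero idempotents have scalar parts adding up to at least `1`, whereas `ofSphere u`
      -- has scalar part `1/2`.
      have key : ∀ c : SpinFactor d, IsIdem c → c ≠ 0 → 1 / 2 ≤ c.1 := by
        intro c hc hc0
        rcases isIdem_cases hc with h | rfl | ⟨v, -, rfl⟩
        · exact absurd h hc0
        · norm_num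
        · exact le_refl _
      have h := congrArg Prod.fst hab
      have h1 := key a ha ha0
      have h2 := key b hb hb0
      simp only [Prod.fst_add, ofSphere] at h
      linarith

theorem ip_ofSphere (u v : EuclideanSpace ℝ (Fin (d + 1))) :
    ip (ofSphere u) (ofSphere v) = (1 + inner ℝ u v) / 2 := by
  simp only [ip, trace, jmul, ofSphere, real_inner_smul_left, real_inner_smul_right]
  ring

theorem ofSphere_injective : Function.Injective (ofSphere (d := d)) := by
  intro u v h
  have := congrArg Prod.snd h
  simpa [ofSphere] using this

/-- The vector `u` of a primitive idempotent `(1/2)(1, u)`. -/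
def direction (c : SpinFactor d) : EuclideanSpace ℝ (Fin (d + 1)) := (2 : ℝ) • c.2

theorem direction_ofSphere (u : EuclideanSpace ℝ (Fin (d + 1))) : direction (ofSphere u) = u := by
  simp [direction, ofSphere, smul_smul]

theorem IsPrimitiveIdem.ofSphere_direction {c : SpinFactor d} (hc : IsPrimitiveIdem c) :
    ofSphere (direction c) = c := by
  obtain ⟨u, -, rfl⟩ := isPrimitiveIdem_iff.1 hc
  rw [direction_ofSphere]

theorem IsPrimitiveIdem.norm_direction {c : SpinFactor d} (hc : IsPrimitiveIdem c) :
    ‖direction c‖ = 1 := by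
  obtain ⟨u, hu, rfl⟩ := isPrimitiveIdem_iff.1 hc
  rwa [direction_ofSphere]

theorem IsPrimitiveIdem.ip_eq {x y : SpinFactor d} (hx : IsPrimitiveIdem x)
    (hy : IsPrimitiveIdem y) : ip x y = (1 + inner ℝ (direction x) (direction y)) / 2 := by
  rw [← ip_ofSphere, hx.ofSphere_direction, hy.ofSphere_direction]

theorem IsPrimitiveIdem.ip_self {x : SpinFactor d} (hx : IsPrimitiveIdem x) : ip x x = 1 := by
  rw [hx.ip_eq hx, real_inner_self_eq_norm_sq, hx.norm_direction]
  norm_num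

theorem IsPrimitiveIdem.eq_of_ip_eq_one {x y : SpinFactor d} (hx : IsPrimitiveIdem x)
    (hy : IsPrimitiveIdem y) (h : ip x y = 1) : x = y := by
  rw [hx.ip_eq hy] at h
  have h1 : inner ℝ (direction x) (direction y) = 1 := by linarith
  rw [← hx.ofSphere_direction, ← hy.ofSphere_direction,
    (inner_eq_one_iff_of_norm_eq_one hx.norm_direction hy.norm_direction).1 h1]

end SpinFactor

/-! ### The kernel matrices of a finite set of primitive idempotents -/

section Kernel

variable {d : ℕ}

theorem eval_jacobiQ_half (d k : ℕ) (t : ℝ) :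
    (jacobiQ 2 d 0 k).eval ((1 + t) / 2) =
      ((d + 2 * k - 1 : ℝ) / (d + k - 1) * (poch d k / poch (d / 2) k)) *
        (jacobi ((d : ℝ) / 2 - 1) (d / 2 - 1) k).eval t := by
  have e : ((2 : ℕ) : ℝ) * d / 2 = d := by push_cast; ring
  have e2 : (d : ℝ) / 2 * ((2 : ℕ) - 1) - 1 = d / 2 - 1 := by push_cast; ring
  rw [jacobiQ, e, e2, eval_mul, eval_C, eval_comp]
  simp only [Nat.cast_zero, add_zero, eval_sub, eval_mul, eval_X, eval_one, eval_ofNat]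
  rw [show 2 * ((1 + t) / 2) - 1 = t by ring]

theorem jacobiQ_factor_nonneg (hd : 1 < d) (k : ℕ) :
    0 ≤ (d + 2 * k - 1 : ℝ) / (d + k - 1) * (poch d k / poch (d / 2) k) := by
  have hd1 : (1 : ℝ) < d := by exact_mod_cast hd
  have hk : (0 : ℝ) ≤ k := by positivity
  have h1 := poch_pos (x := d) (by linarith) k
  have h2 := poch_pos (x := (d : ℝ) / 2) (by linarith) k
  have h3 : (0 : ℝ) < d + 2 * k - 1 := by linarith
  have h4 : (0 : ℝ) < d + k - 1 := by linarith
  positivity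

/-- The sum `Q_n + Q_{n-2} + ⋯` over the indices of the parity of `n`. -/
def paritySum (d : ℕ) : ℕ → ℝ[X]
  | 0 => jacobiQ 2 d 0 0
  | 1 => jacobiQ 2 d 0 1
  | n + 2 => jacobiQ 2 d 0 (n + 2) + paritySum d n

theorem paritySum_zero (d : ℕ) : paritySum d 0 = jacobiQ 2 d 0 0 := rfl

theorem paritySum_one (d : ℕ) : paritySum d 1 = jacobiQ 2 d 0 1 := rfl

theorem paritySum_add_two (d n : ℕ) :
    paritySum d (n + 2) = jacobiQ 2 d 0 (n + 2) + paritySum d n := rfl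

theorem eval_one_paritySum (hd : 1 < d) (n : ℕ) :
    (paritySum d n).eval 1 = (d + n).choose n := by
  induction n using Nat.twoStepInduction with
  | zero => simp [paritySum_zero, eval_one_jacobiQ_zero hd]
  | one => simp [paritySum_one, eval_one_jacobiQ_one hd]
  | more n ih _ => rw [paritySum_add_two, eval_add, ih, eval_one_jacobiQ_add_two hd]

theorem isZonalOfDegree_jacobiQ (hd : 1 < d) (n : ℕ) :
    IsZonalOfDegree d n fun t => (jacobiQ 2 d 0 n).eval ((1 + t) / 2) := by
  simp only [eval_jacobiQ_half]
  exact (isZonalOfDegree_jacobi hd n).const_mul _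

theorem isZonalOfDegree_paritySum (hd : 1 < d) (n : ℕ) :
    IsZonalOfDegree d n fun t => (paritySum d n).eval ((1 + t) / 2) := by
  induction n using Nat.twoStepInduction with
  | zero => rw [paritySum_zero]; exact isZonalOfDegree_jacobiQ hd 0
  | one => rw [paritySum_one]; exact isZonalOfDegree_jacobiQ hd 1
  | more n ih _ =>
    simp only [paritySum_add_two, eval_add]
    exact (isZonalOfDegree_jacobiQ hd (n + 2)).add ih.add_two

/-- The real matrix with entries `p ⟨x, y⟩ / |X|`. -/
def kernelMatrix (X : Finset (SpinFactor d)) (p : ℝ[X]) : Matrix X X ℝ :=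
  Matrix.of fun x y => p.eval (SpinFactor.ip x.1 y.1) / (X.card : ℝ)

theorem kernelMatrix_add (X : Finset (SpinFactor d)) (p q : ℝ[X]) :
    kernelMatrix X (p + q) = kernelMatrix X p + kernelMatrix X q := by
  ext x y; simp [kernelMatrix, add_div]

theorem kernelMatrix_sum (X : Finset (SpinFactor d)) (s : Finset ℕ) (p : ℕ → ℝ[X]) :
    kernelMatrix X (∑ i ∈ s, p i) = ∑ i ∈ s, kernelMatrix X (p i) := by
  ext x y; simp [kernelMatrix, eval_finsetSum, Finset.sum_div, Matrix.sum_apply]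

theorem kernelMatrix_C_mul (X : Finset (SpinFactor d)) (c : ℝ) (p : ℝ[X]) :
    kernelMatrix X (C c * p) = c • kernelMatrix X p := by
  ext x y; simp [kernelMatrix, mul_div_assoc]

theorem kernelMatrix_eq {X : Finset (SpinFactor d)} (hX : ∀ x ∈ X, x.IsPrimitiveIdem)
    (p : ℝ[X]) : kernelMatrix X p = (X.card : ℝ)⁻¹ • Matrix.of fun x y : X =>
      p.eval ((1 + inner ℝ x.1.direction y.1.direction) / 2) := by
  ext x y
  simp [kernelMatrix, (hX x x.2).ip_eq (hX y y.2), div_eq_inv_mul]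

theorem posSemidef_kernelMatrix_jacobiQ (hd : 1 < d) {X : Finset (SpinFactor d)}
    (hX : ∀ x ∈ X, x.IsPrimitiveIdem) (k : ℕ) :
    (kernelMatrix X (jacobiQ 2 d 0 k)).PosSemidef := by
  rw [kernelMatrix_eq hX]
  refine Matrix.PosSemidef.smul ?_ (by positivity)
  have h := (posSemidef_jacobi_inner hd k (u := fun x : X => x.1.direction)
    fun x => (hX x x.2).norm_direction).smul (jacobiQ_factor_nonneg hd k)
  convert h using 1
  ext x y
  simp [eval_jacobiQ_half]

theorem trace_kernelMatrix {X : Finset (SpinFactor d)} (hX : ∀ x ∈ X, x.IsPrimitiveIdem)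
    (hne : X.Nonempty) (p : ℝ[X]) : (kernelMatrix X p).trace = p.eval 1 := by
  have h : ∀ x : X, kernelMatrix X p x x = p.eval 1 / X.card := fun x => by
    simp [kernelMatrix, (hX x x.2).ip_self]
  have hc : (X.card : ℝ) ≠ 0 := by exact_mod_cast hne.card_pos.ne'
  simp only [Matrix.trace, Matrix.diag_apply, h, Finset.sum_const, Finset.card_univ,
    Fintype.card_coe, nsmul_eq_mul]
  field_simp

theorem rank_smul_le {n : Type*} [Fintype n] (c : ℝ) (A : Matrix n n ℝ) :
    (c • A).rank ≤ A.rank := by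
  classical
  have := Matrix.rank_mul_le_left A (c • (1 : Matrix n n ℝ))
  simpa using this

/-- The bound equals the trace of the same matrix by `eval_one_paritySum`. For `Q_n` alone, `n ≥ 2`,
this bound would exceed the trace, which is why sums over one parity are used. -/
theorem rank_kernelMatrix_paritySum_le (hd : 1 < d) {X : Finset (SpinFactor d)}
    (hX : ∀ x ∈ X, x.IsPrimitiveIdem) (n : ℕ) :
    (kernelMatrix X (paritySum d n)).rank ≤ (d + n).choose n := by
  rw [kernelMatrix_eq hX]
  exact (rank_smul_le _ _).trans ((isZonalOfDegree_paritySum hd n).rank_le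
    (u := fun x : X => x.1.direction) fun x => (hX x x.2).norm_direction)

theorem posSemidef_kernelMatrix_paritySum (hd : 1 < d) {X : Finset (SpinFactor d)}
    (hX : ∀ x ∈ X, x.IsPrimitiveIdem) (n : ℕ) :
    (kernelMatrix X (paritySum d n)).PosSemidef := by
  induction n using Nat.twoStepInduction with
  | zero => rw [paritySum_zero]; exact posSemidef_kernelMatrix_jacobiQ hd hX 0
  | one => rw [paritySum_one]; exact posSemidef_kernelMatrix_jacobiQ hd hX 1
  | more n ih _ =>
    rw [paritySum_add_two, kernelMatrix_add]
    exact (posSemidef_kernelMatrix_jacobiQ hd hX _).add ih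

/-- What remains is the sum over the indices of the opposite parity. -/
theorem posSemidef_sum_sub_paritySum (hd : 1 < d) {X : Finset (SpinFactor d)}
    (hX : ∀ x ∈ X, x.IsPrimitiveIdem) (n : ℕ) :
    (∑ i ∈ Finset.range (n + 1), kernelMatrix X (jacobiQ 2 d 0 i) -
      kernelMatrix X (paritySum d n)).PosSemidef := by
  induction n using Nat.twoStepInduction with
  | zero => simpa [paritySum_zero] using Matrix.PosSemidef.zero
  | one =>
    rw [Finset.sum_range_succ, Finset.sum_range_one, paritySum_one, add_sub_cancel_right]
    exact posSemidef_kernelMatrix_jacobiQ hd hX 0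
  | more n ih _ =>
    rw [Finset.sum_range_succ, Finset.sum_range_succ, paritySum_add_two, kernelMatrix_add]
    convert ih.add (posSemidef_kernelMatrix_jacobiQ hd hX (n + 1)) using 1
    abel

end Kernel

/-! ### Tight designs -/

section Tight

variable {d : ℕ}

theorem angleSet_ne_one {X : Finset (SpinFactor d)} (hX : ∀ x ∈ X, x.IsPrimitiveIdem) {α : ℝ}
    (hα : α ∈ angleSet X) : α ≠ 1 := by
  classical
  rintro rfl
  obtain ⟨⟨x, y⟩, hxy, h⟩ := Finset.mem_image.1 hα
  obtain ⟨hx, hy, hxy⟩ := Finset.mem_offDiag.1 hxy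
  exact hxy ((hX x hx).eq_of_ip_eq_one (hX y hy) h)

theorem ip_mem_angleSet {X : Finset (SpinFactor d)} {x y : SpinFactor d} (hx : x ∈ X)
    (hy : y ∈ X) (hxy : x ≠ y) : SpinFactor.ip x y ∈ angleSet X := by
  classical
  exact Finset.mem_image.2 ⟨(x, y), Finset.mem_offDiag.2 ⟨hx, hy, hxy⟩, rfl⟩

theorem eval_one_annihilator {X : Finset (SpinFactor d)} (hX : ∀ x ∈ X, x.IsPrimitiveIdem) :
    (annihilator X).eval 1 = X.card := by
  have h : ∏ α ∈ angleSet X, (1 - α) ≠ 0 :=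
    Finset.prod_ne_zero_iff.2 fun α hα => sub_ne_zero.2 (angleSet_ne_one hX hα).symm
  simp only [annihilator, eval_mul, eval_C, eval_prod, eval_sub, eval_X]
  exact div_mul_cancel₀ _ h

theorem eval_annihilator {X : Finset (SpinFactor d)} {α : ℝ} (hα : α ∈ angleSet X) :
    (annihilator X).eval α = 0 := by
  simp only [annihilator, eval_mul, eval_C, eval_prod, eval_sub, eval_X]
  rw [Finset.prod_eq_zero hα (sub_self α), mul_zero]

namespace IsTightDesign

variable {n : ℕ} {X : Finset (SpinFactor d)}

theorem isPrimitiveIdem {s ε : ℕ} (h : IsTightDesign s ε X) : ∀ x ∈ X, x.IsPrimitiveIdem := h.2.2.1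

theorem annihilator_eq (h : IsTightDesign (n + 1) 1 X) :
    annihilator X = Polynomial.X * jacobiR 2 d 1 n := by
  simpa using h.2.2.2

theorem card_eq (hd : 1 < d) (h : IsTightDesign (n + 1) 1 X) :
    X.card = 2 * (d + n).choose n := by
  have h1 := eval_one_annihilator h.isPrimitiveIdem
  rw [h.annihilator_eq, eval_mul, eval_X, one_mul, eval_one_jacobiR_one hd] at h1
  exact_mod_cast h1.symm

theorem nonempty (hd : 1 < d) (h : IsTightDesign (n + 1) 1 X) : X.Nonempty := by
  rw [← Finset.card_pos, h.card_eq hd]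
  exact mul_pos two_pos (Nat.choose_pos (by omega))

theorem mem_angleSet_iff (hd : 1 < d) (h : IsTightDesign (n + 1) 1 X) {α : ℝ} :
    α ∈ angleSet X ↔ α * (jacobiR 2 d 1 n).eval α = 0 := by
  have h1 := congrArg (eval α) h.annihilator_eq
  rw [eval_mul, eval_X] at h1
  rw [← h1]
  refine ⟨eval_annihilator, fun h2 => ?_⟩
  have h3 : ∏ β ∈ angleSet X, (1 - β) ≠ 0 := Finset.prod_ne_zero_iff.2 fun β hβ =>
    sub_ne_zero.2 (angleSet_ne_one h.isPrimitiveIdem hβ).symm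
  have h4 : (X.card : ℝ) ≠ 0 := by exact_mod_cast (h.nonempty hd).card_pos.ne'
  simp only [annihilator, eval_mul, eval_C, eval_prod, eval_sub, eval_X] at h2
  obtain ⟨β, hβ, h5⟩ := Finset.prod_eq_zero_iff.1
    ((mul_eq_zero.1 h2).resolve_left (div_ne_zero h4 h3))
  rwa [sub_eq_zero.1 h5]

theorem card_angleSet_le (hd : 1 < d) (h : IsTightDesign (n + 1) 1 X) :
    (angleSet X).card ≤ n + 1 := by
  have h3 : ∏ β ∈ angleSet X, (1 - β) ≠ 0 := Finset.prod_ne_zero_iff.2 fun β hβ =>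
    sub_ne_zero.2 (angleSet_ne_one h.isPrimitiveIdem hβ).symm
  have h4 : (X.card : ℝ) ≠ 0 := by exact_mod_cast (h.nonempty hd).card_pos.ne'
  have h5 : (annihilator X).natDegree = (angleSet X).card := by
    rw [annihilator, natDegree_C_mul (div_ne_zero h4 h3), natDegree_finsetProd_X_sub_C_eq_card]
  rw [← h5, h.annihilator_eq]
  refine natDegree_mul_le.trans ?_
  rw [natDegree_X]
  have := natDegree_jacobiR_le hd 1 n
  omega

open Classical in
-- The left side is the kernel matrix of the annihilator, which takes the value `|X|` at `1` and `0`
-- at every angle.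
theorem sum_kernelMatrix (hd : 1 < d) (h : IsTightDesign (n + 1) 1 X) :
    ∑ i ∈ Finset.range (n + 1), kernelMatrix X (jacobiQ 2 d 0 i) +
      ((n + 1 : ℝ) / (2 * n + d + 1)) • kernelMatrix X (jacobiQ 2 d 0 (n + 1)) = 1 := by
  rw [← kernelMatrix_sum, ← kernelMatrix_C_mul, ← kernelMatrix_add, ← X_mul_jacobiR_one hd,
    ← h.annihilator_eq]
  have h4 : (X.card : ℝ) ≠ 0 := by exact_mod_cast (h.nonempty hd).card_pos.ne'
  ext x y
  by_cases hxy : x = y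
  · subst hxy
    simp [kernelMatrix, (h.isPrimitiveIdem x x.2).ip_self, eval_one_annihilator h.isPrimitiveIdem,
      h4]
  · rw [Matrix.one_apply_ne hxy]
    simp [kernelMatrix, eval_annihilator
      (ip_mem_angleSet x.2 y.2 fun e => hxy (Subtype.ext e))]

open Classical in
theorem posSemidef_one_sub_sum (hd : 1 < d) (h : IsTightDesign (n + 1) 1 X) {t : Finset ℕ}
    (ht : t ⊆ Finset.range (n + 1)) :
    (1 - ∑ i ∈ t, kernelMatrix X (jacobiQ 2 d 0 i)).PosSemidef := by
  have hp := posSemidef_kernelMatrix_jacobiQ hd h.isPrimitiveIdem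
  have hs := h.sum_kernelMatrix hd
  rw [← Finset.sum_sdiff ht] at hs
  rw [← hs, add_right_comm, add_sub_cancel_right]
  exact (Matrix.posSemidef_sum _ fun i _ => hp i).add ((hp _).smul (by positivity))

theorem paritySum_mul_self (hd : 1 < d) (h : IsTightDesign (n + 1) 1 X) {i : ℕ} (hi : i ≤ n) :
    kernelMatrix X (paritySum d i) * kernelMatrix X (paritySum d i) =
      kernelMatrix X (paritySum d i) := by
  classical
  refine (posSemidef_kernelMatrix_paritySum hd h.isPrimitiveIdem i).isIdempotentElem_of_rank_le_trace
    ?_ ?_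
  · have h1 := h.posSemidef_one_sub_sum hd (t := Finset.range (i + 1))
      (Finset.range_subset_range.2 (by omega))
    have h2 := posSemidef_sum_sub_paritySum hd h.isPrimitiveIdem i
    simpa using h1.add h2
  · rw [trace_kernelMatrix h.isPrimitiveIdem (h.nonempty hd), eval_one_paritySum hd]
    exact_mod_cast rank_kernelMatrix_paritySum_le hd h.isPrimitiveIdem i

theorem jacobiQ_mul_self (hd : 1 < d) (h : IsTightDesign (n + 1) 1 X) {i : ℕ} (hi : i ≤ n) :
    kernelMatrix X (jacobiQ 2 d 0 i) * kernelMatrix X (jacobiQ 2 d 0 i) =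
      kernelMatrix X (jacobiQ 2 d 0 i) := by
  classical
  match i, hi with
  | 0, hi => rw [← paritySum_zero]; exact h.paritySum_mul_self hd hi
  | 1, hi => rw [← paritySum_one]; exact h.paritySum_mul_self hd hi
  | i + 2, hi =>
    have e : kernelMatrix X (jacobiQ 2 d 0 (i + 2)) =
        kernelMatrix X (paritySum d (i + 2)) - kernelMatrix X (paritySum d i) := by
      rw [paritySum_add_two, kernelMatrix_add, add_sub_cancel_right]
    have hp := posSemidef_kernelMatrix_jacobiQ hd h.isPrimitiveIdem (i + 2)
    rw [e] at hp ⊢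
    exact (posSemidef_kernelMatrix_paritySum hd h.isPrimitiveIdem _).sub_isIdempotentElem
      (posSemidef_kernelMatrix_paritySum hd h.isPrimitiveIdem _)
      (h.paritySum_mul_self hd hi) (h.paritySum_mul_self hd (by omega)) hp

theorem jacobiQ_mul_of_ne (hd : 1 < d) (h : IsTightDesign (n + 1) 1 X) {i j : ℕ} (hi : i ≤ n)
    (hj : j ≤ n) (hij : i ≠ j) :
    kernelMatrix X (jacobiQ 2 d 0 i) * kernelMatrix X (jacobiQ 2 d 0 j) = 0 := by
  classical
  have hp := posSemidef_kernelMatrix_jacobiQ hd h.isPrimitiveIdem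
  refine (hp i).mul_eq_zero_of_add_le_one (hp j) (h.jacobiQ_mul_self hd hi)
    (h.jacobiQ_mul_self hd hj) ?_
  have h1 := h.posSemidef_one_sub_sum hd (t := {i, j}) (by
    intro k hk
    simp only [Finset.mem_insert, Finset.mem_singleton] at hk
    simp only [Finset.mem_range]
    omega)
  rwa [Finset.sum_pair hij, ← sub_sub] at h1

end IsTightDesign

end Tight

/-! ### Orthogonal families of idempotents -/

section Idempotents

variable {K A ι : Type*} [Field K] [Ring A] [Algebra K A] [DecidableEq ι]

theorem linearIndependent_of_orthogonal_idempotents {E : ι → A}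
    (hE : ∀ i j, E i * E j = if i = j then E i else 0) (h0 : ∀ i, E i ≠ 0) :
    LinearIndependent K E := by
  rw [linearIndependent_iff']
  intro s c hc i hi
  have h := congrArg (· * E i) hc
  simp only [Finset.sum_mul, smul_mul_assoc, hE, zero_mul, smul_ite, smul_zero,
    Finset.sum_ite_eq', hi, if_true] at h
  exact (smul_eq_zero.1 h).resolve_right (h0 i)

/-- Two bases of orthogonal idempotents of the same commutative algebra agree up to order. -/
theorem orthogonal_idempotents_unique [Fintype ι] {E F : ι → A}
    (hE : ∀ i j, E i * E j = if i = j then E i else 0) (hE0 : ∀ i, E i ≠ 0)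
    (hF : ∀ i j, F i * F j = if i = j then F i else 0) (hF0 : ∀ i, F i ≠ 0)
    (hFE : ∀ i, F i ∈ Submodule.span K (Set.range E)) (i : ι) : ∃ j, F i = E j := by
  choose c hc using fun i => (Submodule.mem_span_range_iff_exists_fun K).1 (hFE i)
  have hmul : ∀ i j, F i * E j = c i j • E j := by
    intro i j
    rw [← hc i]
    simp [Finset.sum_mul, hE]
  -- Multiplying by `E j` reads off the `j`-th coordinate. Hence the rows of `c` have entries `0` or
  -- `1`, and different rows have disjoint supports.
  have hcc : ∀ i k j, c i j * c k j = if i = k then c i j else 0 := by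
    intro i k j
    have h : F i * F k * E j = (c i j * c k j) • E j := by
      rw [mul_assoc, hmul k j, mul_smul_comm, hmul i j, smul_smul, mul_comm]
    rw [hF] at h
    by_cases hik : i = k
    · rw [if_pos hik, hmul] at h
      rw [if_pos hik]
      exact (smul_left_injective K (hE0 j) h).symm
    · rw [if_neg hik, zero_mul] at h
      rw [if_neg hik]
      exact (smul_eq_zero.1 h.symm).resolve_right (hE0 j)
  have hex : ∀ i, ∃ j, c i j ≠ 0 := by
    intro i
    by_contra! h
    exact hF0 i (by rw [← hc i]; simp [h])
  choose f hf using hex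
  have hinj : Function.Injective f := by
    intro i k hik
    by_contra hne
    have h := hcc i k (f i)
    rw [if_neg hne] at h
    rcases mul_eq_zero.1 h with h | h
    · exact hf i h
    · rw [hik] at h; exact hf k h
  -- The supports are nonempty, disjoint and as many as there are columns, so each is a single
  -- column.
  have hsurj := Finite.surjective_of_injective hinj
  refine ⟨f i, ?_⟩
  rw [← hc i, Finset.sum_eq_single (f i)]
  · have h := hcc i i (f i)
    rw [if_pos rfl] at h
    rw [(mul_eq_left₀ (hf i)).1 h, one_smul]
  · intro j _ hj
    obtain ⟨k, rfl⟩ := hsurj j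
    have hik : i ≠ k := fun e => hj (by rw [e])
    have h := hcc i k (f k)
    rw [if_neg hik] at h
    rw [(mul_eq_zero.1 h).resolve_right (hf k), zero_smul]
  · simp

end Idempotents

/-! ### The Bose-Mesner algebra -/

section BoseMesner

variable {d : ℕ} {X : Finset (SpinFactor d)}

/-- Needed for the `L_i` and also for their Galois conjugates, whose entries depend only on the
inner product as well. -/
theorem mem_boseMesner_of_forall_eq (hX : ∀ x ∈ X, x.IsPrimitiveIdem) {M : Matrix X X ℂ}
    (hM : ∀ x y x' y' : X, SpinFactor.ip x.1 y.1 = SpinFactor.ip x'.1 y'.1 → M x y = M x' y') :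
    M ∈ boseMesner X := by
  classical
  obtain ⟨g, hg⟩ : ∃ g : ℝ → ℂ, ∀ x y : X, M x y = g (SpinFactor.ip x.1 y.1) := by
    -- The value `0` is a default for numbers that are not inner products of points of `X`.
    refine ⟨fun r => if h : ∃ p : X × X, SpinFactor.ip p.1.1 p.2.1 = r
      then M h.choose.1 h.choose.2 else 0, fun x y => ?_⟩
    have h : ∃ p : X × X, SpinFactor.ip p.1.1 p.2.1 = SpinFactor.ip x.1 y.1 := ⟨(x, y), rfl⟩
    dsimp only
    rw [dif_pos h]
    exact hM _ _ _ _ h.choose_spec.symm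
  have h : M = g 1 • (1 : Matrix X X ℂ) + ∑ α ∈ angleSet X, g α • adjacency X α := by
    ext x y
    rw [hg, Matrix.add_apply, Matrix.smul_apply, Matrix.sum_apply]
    by_cases hxy : x = y
    · subst hxy
      rw [(hX x x.2).ip_self, Matrix.one_apply_eq, smul_eq_mul, mul_one, Finset.sum_eq_zero,
        add_zero]
      intro α hα
      simp [adjacency, (hX x x.2).ip_self, (angleSet_ne_one hX hα).symm]
    · rw [Matrix.one_apply_ne hxy, smul_zero, zero_add,
        Finset.sum_eq_single (SpinFactor.ip x.1 y.1)]
      · simp [adjacency]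
      · intro α _ hα
        simp [adjacency, hα.symm]
      · intro h
        exact absurd (ip_mem_angleSet x.2 y.2 fun e => hxy (Subtype.ext e)) h
  rw [h]
  refine add_mem (Submodule.smul_mem _ _ (Submodule.subset_span ?_))
    (sum_mem fun α hα => Submodule.smul_mem _ _ (Submodule.subset_span ?_))
  · exact Or.inl (by congr!)
  · exact Or.inr ⟨α, hα, rfl⟩

theorem finrank_boseMesner_le (X : Finset (SpinFactor d)) :
    Module.finrank ℂ (boseMesner X) ≤ (angleSet X).card + 1 := by
  classical
  let T : Finset (Matrix X X ℂ) := insert 1 ((angleSet X).image (adjacency X))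
  have hT : boseMesner X = Submodule.span ℂ (T : Set (Matrix X X ℂ)) := by
    rw [boseMesner]
    simp only [T, Finset.coe_insert, Finset.coe_image]
  rw [hT]
  exact (finrank_span_finset_le_card T).trans
    ((Finset.card_insert_le _ _).trans (Nat.succ_le_succ Finset.card_image_le))

end BoseMesner

/-! ### The idempotents of a tight design -/

section Scheme

variable {d n : ℕ} {X : Finset (SpinFactor d)}

theorem jacobiMatrix_eq_map (X : Finset (SpinFactor d)) (i : ℕ) :
    jacobiMatrix X i = (kernelMatrix X (jacobiQ 2 d 0 i)).map Complex.ofRealHom := rfl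

theorem schemeIdempotent_of_le {i : ℕ} (hi : i ≤ n) :
    schemeIdempotent X (n + 1) i = jacobiMatrix X i := if_pos (Nat.lt_succ_of_le hi)

open Classical in
theorem schemeIdempotent_self :
    schemeIdempotent X (n + 1) (n + 1) = 1 - ∑ j ∈ Finset.range (n + 1), jacobiMatrix X j :=
  if_neg (lt_irrefl _)

/-- The dimension of the space of spherical harmonics of degree `i`. -/
def harmonicDim (d : ℕ) : ℕ → ℕ
  | 0 => 1
  | k + 1 => (d + k).choose (k + 1) + (d + k - 1).choose k

theorem eval_one_jacobiQ_eq_harmonicDim {d : ℕ} (hd : 1 < d) (i : ℕ) :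
    (jacobiQ 2 d 0 i).eval 1 = harmonicDim d i := by
  cases i with
  | zero => simp [harmonicDim, eval_one_jacobiQ_zero hd]
  | succ k => rw [eval_one_jacobiQ_succ hd, harmonicDim]; push_cast; rfl

/-- The multiplicity of the `i`-th idempotent of a tight design. -/
def schemeMultiplicity (d n i : ℕ) : ℕ :=
  if i ≤ n then harmonicDim d i else (d + n - 1).choose n

theorem schemeMultiplicity_pos {d : ℕ} (hd : 1 < d) (n i : ℕ) :
    0 < schemeMultiplicity d n i := by
  rw [schemeMultiplicity]
  split_ifs with hi
  · cases i with
    | zero => simp [harmonicDim]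
    | succ k =>
      rw [harmonicDim]
      exact Nat.add_pos_left (Nat.choose_pos (by omega)) _
  · exact Nat.choose_pos (by omega)

namespace IsTightDesign

theorem jacobiMatrix_mul (hd : 1 < d) (h : IsTightDesign (n + 1) 1 X) {i j : ℕ} (hi : i ≤ n)
    (hj : j ≤ n) : jacobiMatrix X i * jacobiMatrix X j = if i = j then jacobiMatrix X i else 0 := by
  simp only [jacobiMatrix_eq_map, ← Matrix.map_mul]
  split_ifs with hij
  · subst hij; rw [h.jacobiQ_mul_self hd hi]
  · rw [h.jacobiQ_mul_of_ne hd hi hj hij, Matrix.map_zero _ (map_zero _)]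

theorem schemeIdempotent_mul (hd : 1 < d) (h : IsTightDesign (n + 1) 1 X)
    (i j : Fin (n + 1 + 1)) : schemeIdempotent X (n + 1) i * schemeIdempotent X (n + 1) j =
      if i = j then schemeIdempotent X (n + 1) i else 0 := by
  have hl : ∀ i ≤ n, jacobiMatrix X i * ∑ j ∈ Finset.range (n + 1), jacobiMatrix X j =
      jacobiMatrix X i := by
    intro i hi
    rw [Finset.mul_sum, Finset.sum_congr rfl fun j hj =>
      h.jacobiMatrix_mul hd hi (Nat.lt_succ_iff.1 (Finset.mem_range.1 hj)), Finset.sum_ite_eq,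
      if_pos (Finset.mem_range.2 (Nat.lt_succ_of_le hi))]
  have hr : ∀ i ≤ n, (∑ j ∈ Finset.range (n + 1), jacobiMatrix X j) * jacobiMatrix X i =
      jacobiMatrix X i := by
    intro i hi
    rw [Finset.sum_mul, Finset.sum_congr rfl fun j hj =>
      h.jacobiMatrix_mul hd (Nat.lt_succ_iff.1 (Finset.mem_range.1 hj)) hi, Finset.sum_ite_eq',
      if_pos (Finset.mem_range.2 (Nat.lt_succ_of_le hi))]
  have hs : (∑ j ∈ Finset.range (n + 1), jacobiMatrix X j) *
      (∑ j ∈ Finset.range (n + 1), jacobiMatrix X j) =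
      ∑ j ∈ Finset.range (n + 1), jacobiMatrix X j := by
    rw [Finset.sum_mul]
    exact Finset.sum_congr rfl fun j hj => hl j (Nat.lt_succ_iff.1 (Finset.mem_range.1 hj))
  obtain ⟨i, hi⟩ := i
  obtain ⟨j, hj⟩ := j
  simp only [Fin.mk.injEq]
  rcases Nat.lt_or_ge n i with hi' | hi' <;> rcases Nat.lt_or_ge n j with hj' | hj'
  · obtain rfl : i = n + 1 := by omega
    obtain rfl : j = n + 1 := by omega
    rw [if_pos rfl, schemeIdempotent_self, mul_sub, mul_one, sub_mul, one_mul, hs, sub_self,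
      sub_zero]
  · obtain rfl : i = n + 1 := by omega
    rw [if_neg (by omega), schemeIdempotent_self, schemeIdempotent_of_le hj', sub_mul, one_mul,
      hr j hj', sub_self]
  · obtain rfl : j = n + 1 := by omega
    rw [if_neg (by omega), schemeIdempotent_self, schemeIdempotent_of_le hi', mul_sub, mul_one,
      hl i hi', sub_self]
  · rw [schemeIdempotent_of_le hi', schemeIdempotent_of_le hj', h.jacobiMatrix_mul hd hi' hj']

theorem trace_jacobiMatrix (hd : 1 < d) (h : IsTightDesign (n + 1) 1 X) (i : ℕ) :
    (jacobiMatrix X i).trace = ((jacobiQ 2 d 0 i).eval 1 : ℝ) := by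
  rw [jacobiMatrix_eq_map, ← trace_kernelMatrix h.isPrimitiveIdem (h.nonempty hd)]
  simp [Matrix.trace]

theorem trace_schemeIdempotent_self (hd : 1 < d) (h : IsTightDesign (n + 1) 1 X) :
    (schemeIdempotent X (n + 1) (n + 1)).trace = ((d + n - 1).choose n : ℕ) := by
  have h1 := sum_eval_one_jacobiQ hd n
  have h2 : (X.card : ℝ) = 2 * (d + n).choose n := by exact_mod_cast h.card_eq hd
  rw [← h2] at h1
  rw [schemeIdempotent_self, Matrix.trace_sub, Matrix.trace_one, Matrix.trace_sum,
    Fintype.card_coe, Finset.sum_congr rfl fun i _ => h.trace_jacobiMatrix hd i]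
  have h3 := congrArg (fun r : ℝ => (r : ℂ)) h1
  push_cast at h3 ⊢
  rw [← h3]
  ring

theorem trace_schemeIdempotent (hd : 1 < d) (h : IsTightDesign (n + 1) 1 X)
    (i : Fin (n + 1 + 1)) :
    (schemeIdempotent X (n + 1) i).trace = (schemeMultiplicity d n i : ℕ) := by
  rw [schemeMultiplicity]
  split_ifs with hi
  · rw [schemeIdempotent_of_le hi, h.trace_jacobiMatrix hd, eval_one_jacobiQ_eq_harmonicDim hd]
    simp
  · rw [show (i : ℕ) = n + 1 by omega, h.trace_schemeIdempotent_self hd]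

theorem rank_schemeIdempotent (hd : 1 < d) (h : IsTightDesign (n + 1) 1 X)
    (i : Fin (n + 1 + 1)) : (schemeIdempotent X (n + 1) i).rank = schemeMultiplicity d n i := by
  classical
  have h1 := h.schemeIdempotent_mul hd i i
  rw [if_pos rfl] at h1
  have h2 := Matrix.rank_eq_trace_of_isIdempotentElem h1
  rw [h.trace_schemeIdempotent hd] at h2
  exact_mod_cast h2

theorem schemeIdempotent_ne_zero (hd : 1 < d) (h : IsTightDesign (n + 1) 1 X)
    (i : Fin (n + 1 + 1)) : schemeIdempotent X (n + 1) i ≠ 0 := by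
  intro h0
  have h1 := h.trace_schemeIdempotent hd i
  rw [h0, Matrix.trace_zero, eq_comm, Nat.cast_eq_zero] at h1
  exact (schemeMultiplicity_pos hd n i).ne' h1

theorem linearIndependent_schemeIdempotent (hd : 1 < d) (h : IsTightDesign (n + 1) 1 X) :
    LinearIndependent ℂ (fun i : Fin (n + 1 + 1) => schemeIdempotent X (n + 1) i) := by
  classical
  exact linearIndependent_of_orthogonal_idempotents (h.schemeIdempotent_mul hd)
    (h.schemeIdempotent_ne_zero hd)

theorem schemeIdempotent_apply_eq (h : IsTightDesign (n + 1) 1 X) (i : ℕ) {x y x' y' : X}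
    (hxy : SpinFactor.ip x.1 y.1 = SpinFactor.ip x'.1 y'.1) :
    schemeIdempotent X (n + 1) i x y = schemeIdempotent X (n + 1) i x' y' := by
  classical
  have hj : ∀ j, jacobiMatrix X j x y = jacobiMatrix X j x' y' := fun j => by
    simp [jacobiMatrix, hxy]
  have hx : x = y ↔ x' = y' := by
    have key : ∀ x y : X, x = y ↔ SpinFactor.ip x.1 y.1 = 1 := fun x y =>
      ⟨fun e => by rw [e]; exact (h.isPrimitiveIdem y y.2).ip_self, fun e => Subtype.ext
        ((h.isPrimitiveIdem x x.2).eq_of_ip_eq_one (h.isPrimitiveIdem y y.2) e)⟩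
    rw [key, key, hxy]
  rw [schemeIdempotent]
  split_ifs
  · exact hj i
  · rw [Matrix.sub_apply, Matrix.sub_apply, Matrix.sum_apply, Matrix.sum_apply,
      Finset.sum_congr rfl fun j _ => hj j, Matrix.one_apply, Matrix.one_apply]
    simp only [hx]

/-- There are `n + 2` independent elements in a space of dimension at most `|A(X)| + 1 ≤ n + 2`. -/
theorem span_schemeIdempotent (hd : 1 < d) (h : IsTightDesign (n + 1) 1 X) :
    Submodule.span ℂ (Set.range fun i : Fin (n + 1 + 1) => schemeIdempotent X (n + 1) i) =
      boseMesner X := by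
  refine Submodule.eq_of_le_of_finrank_le ?_ ?_
  · rw [Submodule.span_le]
    rintro _ ⟨i, rfl⟩
    exact mem_boseMesner_of_forall_eq h.isPrimitiveIdem fun _ _ _ _ =>
      h.schemeIdempotent_apply_eq i
  · rw [finrank_span_eq_card (h.linearIndependent_schemeIdempotent hd), Fintype.card_fin]
    exact (finrank_boseMesner_le X).trans (Nat.succ_le_succ (h.card_angleSet_le hd))

end IsTightDesign

/-! ### Comparison of the multiplicities -/

theorem choose_add_succ_mono (e k : ℕ) : (e + k).choose k ≤ (e + (k + 1)).choose (k + 1) := by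
  rw [← add_assoc, Nat.choose_succ_succ]
  exact Nat.le_add_right _ _

theorem choose_add_mono (e : ℕ) : Monotone fun k => (e + k).choose k :=
  monotone_nat_of_le_succ (choose_add_succ_mono e)

theorem harmonicDim_one (d : ℕ) : harmonicDim d 1 = d + 1 := by simp [harmonicDim]

theorem lt_harmonicDim (hd : 1 < d) (k : ℕ) : d + 1 < harmonicDim d (k + 2) := by
  obtain ⟨e, rfl⟩ : ∃ e, d = e + 1 := ⟨d - 1, by omega⟩
  have h1 : (e + 1).choose 1 ≤ (e + (k + 1)).choose (k + 1) := choose_add_mono e (by omega)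
  have h2 : (e + 1).choose 1 ≤ (e + (k + 2)).choose (k + 2) := choose_add_mono e (by omega)
  rw [Nat.choose_one_right] at h1 h2
  rw [harmonicDim, show e + 1 + (k + 1) = e + (k + 2) by omega,
    show e + (k + 2) - 1 = e + (k + 1) by omega, show k + 1 + 1 = k + 2 from rfl]
  omega

/-- The binomial is `d` for `n = 1` and `d(d+1)/2` for `n = 2`; from `n = 3` on, monotonicity in `n`
keeps it above `d + 1`. -/
theorem choose_eq_add_one_iff (hd : 1 < d) (hn : 1 ≤ n) :
    (d + n - 1).choose n = d + 1 ↔ d = 2 ∧ n = 2 := by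
  obtain ⟨e, rfl⟩ : ∃ e, d = e + 1 := ⟨d - 1, by omega⟩
  rw [show e + 1 + n - 1 = e + n by omega]
  have c2 : (e + 2).choose 2 = e + 1 + (e + 1).choose 2 := by
    rw [Nat.choose_succ_succ' (e + 1) 1, Nat.choose_one_right]
  have c2' : (e + 1).choose 2 = e + e.choose 2 := by
    rw [Nat.choose_succ_succ' e 1, Nat.choose_one_right]
  have c3 : (e + 3).choose 3 = (e + 2).choose 2 + (e + 2).choose 3 := by
    rw [Nat.choose_succ_succ' (e + 2) 2]
  rcases Nat.lt_or_ge n 2 with h | h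
  · obtain rfl : n = 1 := by omega
    rw [Nat.choose_one_right]
    omega
  · rcases Nat.lt_or_ge n 3 with h3 | h3
    · obtain rfl : n = 2 := by omega
      rw [c2, c2']
      constructor
      · intro h; omega
      · rintro ⟨h, -⟩
        obtain rfl : e = 1 := by omega
        rfl
    · have h4 : (e + 3).choose 3 ≤ (e + n).choose n := choose_add_mono e h3
      have h5 : 0 < (e + 2).choose 3 := Nat.choose_pos (by omega)
      omega

theorem eq_one_of_schemeMultiplicity_eq (hd : 1 < d) (hn : 1 ≤ n) (hdn : ¬ (d = 2 ∧ n = 2))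
    {i : ℕ} (h : schemeMultiplicity d n i = schemeMultiplicity d n 1) : i = 1 := by
  rw [schemeMultiplicity, schemeMultiplicity, if_pos hn, harmonicDim_one] at h
  split_ifs at h with hi
  · match i, h with
    | 0, h => simp [harmonicDim] at h; omega
    | 1, _ => rfl
    | k + 2, h => exact absurd h (lt_harmonicDim hd k).ne'
  · exact absurd ((choose_eq_add_one_iff hd hn).1 h) hdn

end Scheme

/-! ### Rationality of the angle set -/

section Rational

/-- An algebraic number that is fixed by all embeddings of the algebraic closure is rational. -/
theorem exists_rat_of_forall_algHom_eq (a : algebraicClosure ℚ ℂ)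
    (h : ∀ τ : algebraicClosure ℚ ℂ →ₐ[ℚ] ℂ, τ a = a) : ∃ q : ℚ, (a : ℂ) = q := by
  have : Algebra.IsAlgebraic ℚ (algebraicClosure ℚ ℂ) := algebraicClosure.isAlgebraic ℚ ℂ
  have hr := Algebra.IsAlgebraic.range_eval_eq_rootSet_minpoly (F := ℚ) (K := algebraicClosure ℚ ℂ)
    ℂ a
  -- The values `τ a` are exactly the roots of the minimal polynomial. If there is only one,
  -- separability makes the degree `1`.
  have hset : (minpoly ℚ a).rootSet ℂ = {(a : ℂ)} := by
    rw [← hr]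
    refine Set.eq_singleton_iff_unique_mem.2 ⟨⟨(algebraicClosure ℚ ℂ).val, rfl⟩, ?_⟩
    rintro _ ⟨τ, rfl⟩
    exact h τ
  have hint : IsIntegral ℚ a := Algebra.IsIntegral.isIntegral a
  have hcard := card_rootSet_eq_natDegree (K := ℂ) (minpoly.irreducible hint).separable
    (IsAlgClosed.splits _)
  have hdeg : (minpoly ℚ a).natDegree = 1 := by
    rw [← hcard, ← Nat.card_eq_fintype_card, hset]
    simp
  obtain ⟨q, hq⟩ := minpoly.mem_range_of_degree_eq_one ℚ a
    ((degree_eq_iff_natDegree_eq (minpoly.ne_zero hint)).2 hdeg)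
  refine ⟨q, ?_⟩
  rw [← hq]
  simp

theorem isAlgebraic_eval_of_mem_lifts {p : ℝ[X]} (hp : p ∈ lifts (algebraMap ℚ ℝ)) {a : ℝ}
    (ha : IsAlgebraic ℚ a) : IsAlgebraic ℚ (p.eval a) := by
  obtain ⟨q, rfl⟩ := (mem_lifts p).1 hp
  rw [eval_map_algebraMap]
  have ha' : a ∈ algebraicClosure ℚ ℝ := mem_algebraicClosure_iff.2 ha
  have e := aeval_algHom_apply (algebraicClosure ℚ ℝ).val ⟨a, ha'⟩ q
  rw [← mem_algebraicClosure_iff]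
  exact e ▸ SetLike.coe_mem _

variable {d n : ℕ} {X : Finset (SpinFactor d)}

/-- If a multiplicity of an algebraic basis of orthogonal idempotents of the Bose-Mesner algebra
occurs only once, then the corresponding idempotent has rational entries. -/
theorem rational_of_unique_trace (hX : ∀ x ∈ X, x.IsPrimitiveIdem) {ι : Type*} [Fintype ι]
    [DecidableEq ι] {E : ι → Matrix X X ℂ} (hE : ∀ i j, E i * E j = if i = j then E i else 0)
    (hspan : Submodule.span ℂ (Set.range E) = boseMesner X)
    (hconst : ∀ i (x y x' y' : X), SpinFactor.ip x.1 y.1 = SpinFactor.ip x'.1 y'.1 →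
      E i x y = E i x' y')
    (halg : ∀ i x y, IsAlgebraic ℚ (E i x y)) {m : ι → ℕ} (hm : ∀ i, m i ≠ 0)
    (htr : ∀ i, (E i).trace = m i) {i₀ : ι} (hi₀ : ∀ i, m i = m i₀ → i = i₀) (x y : X) :
    ∃ q : ℚ, E i₀ x y = q := by
  classical
  have hne : ∀ i, E i ≠ 0 := fun i h0 => by
    have h := htr i
    rw [h0, Matrix.trace_zero, eq_comm, Nat.cast_eq_zero] at h
    exact hm i h
  -- The matrices `E i` over the field of algebraic numbers, on which the embeddings `τ` act.
  let L : ι → Matrix X X (algebraicClosure ℚ ℂ) := fun i => Matrix.of fun x y =>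
    ⟨E i x y, mem_algebraicClosure_iff.2 (halg i x y)⟩
  have hLE : ∀ i, (L i).map (algebraMap (algebraicClosure ℚ ℂ) ℂ) = E i := fun i => rfl
  have hinj : Function.Injective fun M : Matrix X X (algebraicClosure ℚ ℂ) =>
      M.map (algebraMap (algebraicClosure ℚ ℂ) ℂ) :=
    Matrix.map_injective (algebraMap (algebraicClosure ℚ ℂ) ℂ).injective
  have hL : ∀ i j, L i * L j = if i = j then L i else 0 := by
    intro i j
    apply hinj
    dsimp only
    rw [Matrix.map_mul, hLE, hLE, hE]
    split_ifs
    · rfl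
    · exact (Matrix.map_zero _ (map_zero _)).symm
  have hLtr : ∀ i, (L i).trace = m i := by
    intro i
    apply (algebraMap (algebraicClosure ℚ ℂ) ℂ).injective
    rw [AddMonoidHom.map_trace (algebraMap (algebraicClosure ℚ ℂ) ℂ), map_natCast]
    exact htr i
  refine exists_rat_of_forall_algHom_eq (L i₀ x y) fun τ => ?_
  let F : ι → Matrix X X ℂ := fun i => (L i).map τ
  have hF : ∀ i j, F i * F j = if i = j then F i else 0 := by
    intro i j
    have h := congrArg (Matrix.map · τ) (hL i j)
    rw [Matrix.map_mul] at h
    refine h.trans ?_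
    split_ifs
    · rfl
    · exact Matrix.map_zero _ (map_zero _)
  have hFtr : ∀ i, (F i).trace = m i := by
    intro i
    have h := congrArg τ (hLtr i)
    rw [AddMonoidHom.map_trace τ, map_natCast] at h
    exact h
  have hF0 : ∀ i, F i ≠ 0 := fun i h0 => by
    have h := hFtr i
    rw [h0, Matrix.trace_zero, eq_comm, Nat.cast_eq_zero] at h
    exact hm i h
  have hFE : ∀ i, F i ∈ Submodule.span ℂ (Set.range E) := by
    intro i
    rw [hspan]
    refine mem_boseMesner_of_forall_eq hX fun x y x' y' hxy => ?_
    have h : L i x y = L i x' y' := Subtype.ext (hconst i x y x' y' hxy)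
    simp only [F, Matrix.map_apply, h]
  -- The conjugate of `E i₀` is again some `E j`. Its trace is a natural number, hence fixed by `τ`,
  -- and uniqueness of this trace gives `j = i₀`.
  obtain ⟨j, hj⟩ := orthogonal_idempotents_unique hE hne hF hF0 hFE i₀
  have h1 := hFtr i₀
  rw [hj, htr, Nat.cast_inj] at h1
  rw [hi₀ j h1] at hj
  exact congrFun (congrFun hj x) y

theorem eval_jacobiQ_one (hd : 1 < d) (r : ℝ) :
    (jacobiQ 2 d 0 1).eval r = (d + 1) * (2 * r - 1) := by
  have hd1 : (1 : ℝ) < d := by exact_mod_cast hd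
  rw [jacobiQ_two]
  simp [jacobiZ, Finset.sum_range_succ, jacobiCoeff, poch_succ, poch_zero]
  field_simp
  ring

namespace IsTightDesign

theorem isAlgebraic_of_mem_angleSet (hd : 1 < d) (h : IsTightDesign (n + 1) 1 X) {α : ℝ}
    (hα : α ∈ angleSet X) : IsAlgebraic ℚ α := by
  have hC : ∀ q : ℚ, C (q : ℝ) ∈ lifts (algebraMap ℚ ℝ) := fun q => C_mem_lifts _ q
  have hl : annihilator X ∈ lifts (algebraMap ℚ ℝ) := by
    rw [h.annihilator_eq, X_mul_jacobiR_one hd]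
    refine add_mem (sum_mem fun i _ => jacobiQ_mem_lifts d i) (mul_mem ?_ (jacobiQ_mem_lifts d _))
    have := hC ((n + 1) / (2 * n + d + 1))
    push_cast at this
    exact this
  obtain ⟨q, hq⟩ := (mem_lifts _).1 hl
  refine ⟨q, ?_, ?_⟩
  · rintro rfl
    have h1 := eval_one_annihilator h.isPrimitiveIdem
    rw [← hq, Polynomial.map_zero, eval_zero, eq_comm, Nat.cast_eq_zero, Finset.card_eq_zero] at h1
    exact (h.nonempty hd).ne_empty h1
  · rw [← eval_map_algebraMap, hq, eval_annihilator hα]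

theorem isAlgebraic_ip (hd : 1 < d) (h : IsTightDesign (n + 1) 1 X) (x y : X) :
    IsAlgebraic ℚ (SpinFactor.ip x.1 y.1) := by
  by_cases hxy : x = y
  · rw [hxy, (h.isPrimitiveIdem y y.2).ip_self]
    exact isAlgebraic_one
  · exact h.isAlgebraic_of_mem_angleSet hd
      (ip_mem_angleSet x.2 y.2 fun e => hxy (Subtype.ext e))

theorem isAlgebraic_schemeIdempotent (hd : 1 < d) (h : IsTightDesign (n + 1) 1 X) (i : ℕ)
    (x y : X) : IsAlgebraic ℚ (schemeIdempotent X (n + 1) i x y) := by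
  classical
  have hj : ∀ j, jacobiMatrix X j x y ∈ algebraicClosure ℚ ℂ := by
    intro j
    rw [mem_algebraicClosure_iff]
    have h1 := isAlgebraic_eval_of_mem_lifts (jacobiQ_mem_lifts d j) (h.isAlgebraic_ip hd x y)
    have h2 := h1.mul (isAlgebraic_natCast (R := ℚ) X.card).inv
    rw [← div_eq_mul_inv] at h2
    exact h2.algebraMap (A := ℂ)
  rw [← mem_algebraicClosure_iff, schemeIdempotent]
  split_ifs
  · exact hj i
  · rw [Matrix.sub_apply, Matrix.sum_apply]
    refine sub_mem ?_ (sum_mem fun j _ => hj j)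
    rw [Matrix.one_apply]
    split_ifs
    · exact one_mem _
    · exact zero_mem _

theorem rational_angleSet (hd : 1 < d) (h : IsTightDesign (n + 1) 1 X)
    (hdn : ¬ (d = 2 ∧ n = 2)) {α : ℝ} (hα : α ∈ angleSet X) : ∃ q : ℚ, (q : ℝ) = α := by
  classical
  -- For `s = 1` the matrix `L_1` is the complement `L_s`, not the matrix of `Q_1^0`. But then
  -- `R_0^1` is a nonzero constant and the only possible angle is `0`.
  rcases Nat.eq_zero_or_pos n with rfl | hn
  · rw [h.mem_angleSet_iff hd, jacobiR_two hd] at hα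
    have hd1 : (0 : ℝ) < d := by exact_mod_cast (by omega : 0 < d)
    have h2 : (jacobiZ ((d : ℝ) / 2) ((d : ℝ) / 2 - 1 + (1 : ℕ)) 0) = 1 := by
      simp [jacobiZ, jacobiCoeff, poch_zero]
    rw [h2] at hα
    have h3 : poch (d : ℝ) (0 + 1) / poch ((d : ℝ) / 2) (0 + 1) ≠ 0 :=
      (div_pos (poch_pos hd1 _) (poch_pos (by positivity) _)).ne'
    simp only [one_comp, mul_one, eval_C] at hα
    exact ⟨0, by rw [(mul_eq_zero.1 hα).resolve_right h3, Rat.cast_zero]⟩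
  · obtain ⟨⟨x, y⟩, hxy, rfl⟩ := Finset.mem_image.1 hα
    obtain ⟨hx, hy, -⟩ := Finset.mem_offDiag.1 hxy
    have key := rational_of_unique_trace h.isPrimitiveIdem (h.schemeIdempotent_mul hd)
      (h.span_schemeIdempotent hd) (fun i _ _ _ _ => h.schemeIdempotent_apply_eq i)
      (fun i => h.isAlgebraic_schemeIdempotent hd i)
      (fun i => (schemeMultiplicity_pos hd n i).ne') (h.trace_schemeIdempotent hd)
      (i₀ := ⟨1, by omega⟩)
      (fun i hi => Fin.ext (eq_one_of_schemeMultiplicity_eq hd hn hdn hi)) ⟨x, hx⟩ ⟨y, hy⟩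
    obtain ⟨q, hq⟩ := key
    rw [schemeIdempotent_of_le hn] at hq
    simp only [jacobiMatrix, Matrix.of_apply, eval_jacobiQ_one hd] at hq
    -- The entry of `L_1` is an affine function of the angle with rational coefficients.
    have hq' : ((d : ℝ) + 1) * (2 * SpinFactor.ip x y - 1) / X.card = q := by exact_mod_cast hq
    have hc : (X.card : ℝ) ≠ 0 := by exact_mod_cast (h.nonempty hd).card_pos.ne'
    have hd0 : (d : ℝ) + 1 ≠ 0 := by positivity
    refine ⟨(q * X.card / (d + 1) + 1) / 2, ?_⟩
    push_cast
    rw [← hq']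
    field_simp
    ring

end IsTightDesign

end Rational

/-! ### The vertices of the icosahedron -/

section Icosahedron

open Real

/-- The cosine of the angle between adjacent vertices of an icosahedron. -/
def icoCos : ℝ := (2 * goldenRatio - 1) / 5

/-- The scaling factor that puts the vertices on the unit sphere. -/
def icoScale : ℝ := (√(1 + goldenRatio ^ 2))⁻¹

theorem icoCos_sq : icoCos ^ 2 = 1 / 5 := by
  have := goldenRatio_sq
  rw [icoCos]
  linear_combination (4 / 25) * this

theorem sqrt_five_mul_icoCos : √5 * icoCos = 1 := by
  have h : (√5) ^ 2 = 5 := sq_sqrt (by norm_num)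
  rw [icoCos, goldenRatio]
  linear_combination (1 / 5) * h

theorem icoCos_pos : 0 < icoCos := by
  have := one_lt_goldenRatio
  rw [icoCos]
  linarith

theorem icoCos_lt_one : icoCos < 1 := by
  have := goldenRatio_lt_two
  rw [icoCos]
  linarith

theorem irrational_icoCos : Irrational icoCos := by
  have h : Irrational √5 := by
    have := Nat.Prime.irrational_sqrt (p := 5) (by norm_num)
    exact_mod_cast this
  rw [eq_inv_of_mul_eq_one_right sqrt_five_mul_icoCos]
  exact h.inv

theorem icoScale_sq : icoScale ^ 2 * (goldenRatio + 2) = 1 := by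
  have h : (0 : ℝ) < 1 + goldenRatio ^ 2 := by positivity
  rw [icoScale, inv_pow, sq_sqrt h.le, show goldenRatio + 2 = 1 + goldenRatio ^ 2 by
    rw [goldenRatio_sq]; ring]
  exact inv_mul_cancel₀ h.ne'

theorem icoScale_sq_mul : icoScale ^ 2 * goldenRatio = icoCos := by
  have h1 := icoScale_sq
  have h2 := goldenRatio_sq
  rw [icoCos]
  linear_combination ((2 * goldenRatio - 1) / 5) * h1 - (2 / 5) * icoScale ^ 2 * h2

theorem icoScale_ne_zero : icoScale ≠ 0 := by
  intro h
  have := icoScale_sq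
  rw [h] at this
  norm_num at this

/-- The sign encoded by a Boolean. -/
def boolSign (b : Bool) : ℝ := if b then 1 else -1

/-- An enumeration of the vertices of the icosahedron. -/
def icoVertex (p : Fin 3 × Bool × Bool) : EuclideanSpace ℝ (Fin 3) :=
  icoScale • ![!₂[0, boolSign p.2.1, boolSign p.2.2 * goldenRatio],
    !₂[boolSign p.2.1, boolSign p.2.2 * goldenRatio, 0],
    !₂[boolSign p.2.2 * goldenRatio, 0, boolSign p.2.1]] p.1

theorem range_icoVertex : Set.range icoVertex = icosahedronVertices := by
  have hs : ∀ a ∈ ({1, -1} : Set ℝ), ∃ b, a = boolSign b := by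
    rintro a (rfl | rfl)
    · exact ⟨true, rfl⟩
    · exact ⟨false, rfl⟩
  have hs' : ∀ b, boolSign b ∈ ({1, -1} : Set ℝ) := by
    intro b; cases b <;> simp [boolSign]
  ext v
  constructor
  · rintro ⟨⟨i, a, b⟩, rfl⟩
    refine ⟨boolSign a, hs' a, boolSign b, hs' b, _, ?_, rfl⟩
    fin_cases i
    · exact Or.inl rfl
    · exact Or.inr (Or.inl rfl)
    · exact Or.inr (Or.inr rfl)
  · rintro ⟨a, ha, b, hb, w, hw, rfl⟩
    obtain ⟨a, rfl⟩ := hs a ha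
    obtain ⟨b, rfl⟩ := hs b hb
    rcases hw with rfl | rfl | rfl
    · exact ⟨(0, a, b), rfl⟩
    · exact ⟨(1, a, b), rfl⟩
    · exact ⟨(2, a, b), rfl⟩

theorem inner_icoVertex_same (i : Fin 3) (a b a' b' : Bool) :
    inner ℝ (icoVertex (i, a, b)) (icoVertex (i, a', b')) =
      icoScale ^ 2 * (boolSign a * boolSign a' + boolSign b * boolSign b' * (goldenRatio + 1)) := by
  have h := goldenRatio_sq
  fin_cases i <;>
  · simp [icoVertex, PiLp.inner_apply, Fin.sum_univ_three]
    linear_combination (icoScale ^ 2 * boolSign b * boolSign b') * h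

theorem inner_icoVertex_succ (i : Fin 3) (a b a' b' : Bool) :
    inner ℝ (icoVertex (i, a, b)) (icoVertex (i + 1, a', b')) =
      boolSign a * boolSign b' * icoCos := by
  rw [← icoScale_sq_mul]
  fin_cases i <;>
  · simp [icoVertex, PiLp.inner_apply, Fin.sum_univ_three]
    ring

theorem inner_icoVertex_self (p : Fin 3 × Bool × Bool) :
    inner ℝ (icoVertex p) (icoVertex p) = (1 : ℝ) := by
  obtain ⟨i, a, b⟩ := p
  have h := icoScale_sq
  rw [inner_icoVertex_same]
  cases a <;> cases b <;> simp [boolSign] <;> linear_combination h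

theorem inner_icoVertex_of_ne {p q : Fin 3 × Bool × Bool} (hpq : p ≠ q) :
    inner ℝ (icoVertex p) (icoVertex q) = -1 ∨
      inner ℝ (icoVertex p) (icoVertex q) = icoCos ∨
      inner ℝ (icoVertex p) (icoVertex q) = -icoCos := by
  obtain ⟨i, a, b⟩ := p
  obtain ⟨j, a', b'⟩ := q
  have hsign : ∀ a b, boolSign a * boolSign b = 1 ∨ boolSign a * boolSign b = -1 := by
    intro a b; cases a <;> cases b <;> simp [boolSign]
  have h1 := icoScale_sq
  have h2 := icoScale_sq_mul
  -- Two indices modulo `3` are equal or cyclically adjacent, so the two inner product formulas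
  -- cover all pairs.
  have hij : ∀ i j : Fin 3, i = j ∨ j = i + 1 ∨ i = j + 1 := by decide
  rcases hij i j with rfl | rfl | rfl
  · rw [inner_icoVertex_same]
    cases a <;> cases b <;> cases a' <;> cases b' <;> simp [boolSign] at hpq ⊢
    all_goals first
      | (left; linear_combination -h1)
      | (right; left; linear_combination h2)
      | (right; right; linear_combination h2)
  · rw [inner_icoVertex_succ]
    rcases hsign a b' with h | h <;> simp [h]
  · rw [real_inner_comm, inner_icoVertex_succ]
    rcases hsign a' b with h | h <;> simp [h]

theorem norm_icoVertex (p : Fin 3 × Bool × Bool) : ‖icoVertex p‖ = 1 := by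
  rw [norm_eq_sqrt_real_inner, inner_icoVertex_self, sqrt_one]

theorem icoVertex_injective : Function.Injective icoVertex := by
  intro p q h
  by_contra hpq
  have h1 := inner_icoVertex_of_ne hpq
  rw [h, inner_icoVertex_self] at h1
  have h2 := icoCos_pos
  have h3 := icoCos_lt_one
  rcases h1 with h1 | h1 | h1 <;> linarith

/-! ### Icosahedra are tight designs -/

/-- The roots `(1 ± 1/√5)/2` correspond to the cosines `± icoCos`. -/
theorem eval_jacobiR_two_two (x : ℝ) :
    (jacobiR 2 2 1 2).eval x = 12 * (5 * x ^ 2 - 5 * x + 1) := by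
  rw [jacobiR_two (by norm_num)]
  simp [jacobiZ, Finset.sum_range_succ, jacobiCoeff, poch_succ, poch_zero]
  norm_num
  ring

theorem IsRegularIcosahedron.isTightDesign {X : Finset (SpinFactor 2)}
    (h : IsRegularIcosahedron X) : IsTightDesign 3 1 X := by
  classical
  obtain ⟨f, hf⟩ := h
  have hmem : ∀ x, x ∈ X ↔ ∃ p, SpinFactor.ofSphere (f (icoVertex p)) = x := by
    intro x
    rw [← Finset.mem_coe, hf, ← range_icoVertex, ← Set.range_comp]
    rfl
  have hinj : Function.Injective fun p => SpinFactor.ofSphere (f (icoVertex p)) := fun p q h =>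
    icoVertex_injective (f.injective (SpinFactor.ofSphere_injective h))
  have hX : X = Finset.univ.image fun p => SpinFactor.ofSphere (f (icoVertex p)) := by
    ext x; rw [hmem, Finset.mem_image]; simp only [Finset.mem_univ, true_and]
  have hcard : X.card = 12 := by
    rw [hX, Finset.card_image_of_injective _ hinj]; rfl
  have hip : ∀ p q, SpinFactor.ip (SpinFactor.ofSphere (f (icoVertex p)))
      (SpinFactor.ofSphere (f (icoVertex q))) = (1 + inner ℝ (icoVertex p) (icoVertex q)) / 2 := by
    intro p q
    rw [SpinFactor.ip_ofSphere, f.inner_map_map]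
  have hA : angleSet X = {0, (1 + icoCos) / 2, (1 - icoCos) / 2} := by
    ext α
    constructor
    · intro hα
      obtain ⟨⟨x, y⟩, hxy, rfl⟩ := Finset.mem_image.1 hα
      obtain ⟨hx, hy, hne⟩ := Finset.mem_offDiag.1 hxy
      obtain ⟨p, rfl⟩ := (hmem x).1 hx
      obtain ⟨q, rfl⟩ := (hmem y).1 hy
      have hpq : p ≠ q := fun e => hne (by rw [e])
      simp only [hip, Finset.mem_insert, Finset.mem_singleton]
      rcases inner_icoVertex_of_ne hpq with h | h | h <;> rw [h]
      · left; norm_num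
      · right; left; rfl
      · right; right; ring
    · have key : ∀ p q, p ≠ q → (1 + inner ℝ (icoVertex p) (icoVertex q)) / 2 ∈ angleSet X := by
        intro p q hpq
        rw [← hip]
        exact ip_mem_angleSet ((hmem _).2 ⟨p, rfl⟩) ((hmem _).2 ⟨q, rfl⟩) fun e => hpq (hinj e)
      have h1 := icoScale_sq
      intro hα
      simp only [Finset.mem_insert, Finset.mem_singleton] at hα
      rcases hα with rfl | rfl | rfl
      · convert key (0, true, true) (0, false, false) (by decide) using 1
        rw [inner_icoVertex_same]
        simp [boolSign]
        linear_combination (1 / 2) * h1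
      · convert key (0, true, true) (0 + 1, true, true) (by decide) using 1
        rw [inner_icoVertex_succ]
        simp [boolSign]
      · convert key (0, true, true) (0 + 1, true, false) (by decide) using 1
        rw [inner_icoVertex_succ]
        simp [boolSign, sub_eq_add_neg]
  refine ⟨le_refl _, by norm_num, ?_, ?_⟩
  · intro x hx
    obtain ⟨p, rfl⟩ := (hmem x).1 hx
    exact SpinFactor.isPrimitiveIdem_iff.2
      ⟨_, by rw [f.norm_map, norm_icoVertex], rfl⟩
  · have hc := icoCos_pos
    have hc1 := icoCos_lt_one
    have hs := icoCos_sq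
    have n1 : (1 + icoCos) / 2 ∉ ({(1 - icoCos) / 2} : Finset ℝ) := by
      rw [Finset.mem_singleton]; intro h; linarith
    have n2 : (0 : ℝ) ∉ ({(1 + icoCos) / 2, (1 - icoCos) / 2} : Finset ℝ) := by
      rw [Finset.mem_insert, Finset.mem_singleton]
      rintro (h | h) <;> linarith
    -- The normalising product is `(1 - 1/5)/4 = 1/5`, so the annihilator has leading coefficient
    -- `12 · 5 = 60`.
    have hp : (1 - 0 : ℝ) * ((1 - (1 + icoCos) / 2) * (1 - (1 - icoCos) / 2)) = 1 / 5 := by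
      linear_combination (-1 / 4) * hs
    rw [annihilator, hA, Finset.prod_insert n2, Finset.prod_insert n1, Finset.prod_singleton,
      Finset.prod_insert n2, Finset.prod_insert n1, Finset.prod_singleton, hp, hcard]
    refine Polynomial.funext fun x => ?_
    have h2 := eval_jacobiR_two_two x
    simp only [eval_mul, eval_C, eval_sub, eval_X, pow_one, Nat.add_one_sub_one]
    rw [h2]
    push_cast
    linear_combination (-15) * x * hs

theorem exists_isTightDesign_three : ∃ X : Finset (SpinFactor 2), IsTightDesign 3 1 X := by
  classical
  refine ⟨Finset.univ.image fun p => SpinFactor.ofSphere (icoVertex p),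
    IsRegularIcosahedron.isTightDesign ⟨LinearIsometryEquiv.refl ℝ _, ?_⟩⟩
  rw [Finset.coe_image, Finset.coe_univ, Set.image_univ, ← range_icoVertex, ← Set.range_comp]
  rfl

theorem IsTightDesign.not_rational_angleSet {X : Finset (SpinFactor 2)}
    (h : IsTightDesign 3 1 X) : ¬ ∀ α ∈ angleSet X, ∃ q : ℚ, (q : ℝ) = α := by
  intro hr
  have hm : (1 + icoCos) / 2 ∈ angleSet X := by
    rw [IsTightDesign.mem_angleSet_iff (by norm_num) h, eval_jacobiR_two_two]
    linear_combination 6 * (1 + icoCos) * 5 / 4 * icoCos_sq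
  obtain ⟨q, hq⟩ := hr _ hm
  exact irrational_icoCos ⟨2 * q - 1, by push_cast; linarith⟩

end Icosahedron

/-! ### Tight `5`-designs in dimension three are icosahedra -/

section IcosahedronUniqueness

open Real

/-- The coordinates, up to a factor, of a vector whose inner products with the vertices of a
face of the icosahedron are `α`, `β`, `γ`. -/
def faceCoords (α β γ : ℝ) : Fin 3 → ℝ :=
  ![(1 - goldenRatio) * α + β + (2 - goldenRatio) * γ,
    (2 - goldenRatio) * α + (1 - goldenRatio) * β + γ,
    α + (2 - goldenRatio) * β + (1 - goldenRatio) * γ]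

theorem exists_isometry_of_triangle {a b c : EuclideanSpace ℝ (Fin 3)} (ha : ‖a‖ = 1)
    (hb : ‖b‖ = 1) (hc : ‖c‖ = 1) (hab : inner ℝ a b = icoCos) (hbc : inner ℝ b c = icoCos)
    (hca : inner ℝ c a = icoCos) :
    ∃ f : EuclideanSpace ℝ (Fin 3) ≃ₗᵢ[ℝ] EuclideanSpace ℝ (Fin 3), ∀ x : EuclideanSpace ℝ (Fin 3),
      ∀ i, f.symm x i = icoScale⁻¹ / 2 * faceCoords (inner ℝ a x) (inner ℝ b x) (inner ℝ c x) i := by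
  let k : ℝ := icoScale⁻¹ / 2
  -- The coefficients form twice the inverse of the matrix with rows `(0, 1, φ)`, `(φ, 0, 1)`, `(1,
  -- φ, 0)`, a face of the standard icosahedron. In the frame `E` the points `a`, `b`, `c` become
  -- these rows scaled by `icoScale`.
  let E : Fin 3 → EuclideanSpace ℝ (Fin 3) := ![
    k • ((1 - goldenRatio) • a + b + (2 - goldenRatio) • c),
    k • ((2 - goldenRatio) • a + (1 - goldenRatio) • b + c),
    k • (a + (2 - goldenRatio) • b + (1 - goldenRatio) • c)]
  have hk : k ^ 2 = (goldenRatio + 2) / 4 := by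
    have h1 := icoScale_sq
    have h2 := icoScale_ne_zero
    simp only [k]
    field_simp
    linear_combination -4 * h1
  have hφ := goldenRatio_sq
  have haa : inner ℝ a a = (1 : ℝ) := by rw [real_inner_self_eq_norm_sq, ha, one_pow]
  have hbb : inner ℝ b b = (1 : ℝ) := by rw [real_inner_self_eq_norm_sq, hb, one_pow]
  have hcc : inner ℝ c c = (1 : ℝ) := by rw [real_inner_self_eq_norm_sq, hc, one_pow]
  have hba : inner ℝ b a = icoCos := by rw [real_inner_comm, hab]
  have hcb : inner ℝ c b = icoCos := by rw [real_inner_comm, hbc]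
  have hac : inner ℝ a c = icoCos := by rw [real_inner_comm, hca]
  have hE : Orthonormal ℝ E := by
    rw [orthonormal_iff_ite]
    intro i j
    fin_cases i <;> fin_cases j <;>
    · simp only [E, Fin.zero_eta, Fin.mk_one, Fin.reduceFinMk, Matrix.cons_val, inner_add_left,
        inner_add_right, real_inner_smul_left, real_inner_smul_right, haa, hbb, hcc, hab, hba,
        hbc, hcb, hca, hac]
      simp only [icoCos]
      first
        | rw [if_pos (by decide)]
        | rw [if_neg (by decide)]
      grind
  have hspan : ⊤ ≤ Submodule.span ℝ (Set.range E) := by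
    have := hE.linearIndependent.span_eq_top_of_card_eq_finrank (by simp)
    exact this.ge
  let B := OrthonormalBasis.mk hE hspan
  refine ⟨B.repr.symm, fun x i => ?_⟩
  have h : B.repr.symm.symm x i = inner ℝ (E i) x := by
    rw [LinearIsometryEquiv.symm_symm, B.repr_apply_apply]
    simp [B]
  rw [h]
  fin_cases i <;>
  · simp [E, inner_add_left, real_inner_smul_left, k, faceCoords]
    ring

end IcosahedronUniqueness

/-! ### Identifying a point from its inner products with a face -/

section IcosahedronUniqueness

open Real

theorem icoScale_inv_mul_eq {u w : ℝ} (h : u * (goldenRatio + 2) = 2 * w) :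
    icoScale⁻¹ / 2 * u = icoScale * w := by
  have h1 := icoScale_sq
  have h2 := icoScale_ne_zero
  field_simp
  linear_combination icoScale ^ 2 * h - u * h1

theorem eq_icoVertex_of_coords {v : EuclideanSpace ℝ (Fin 3)} {u : Fin 3 → ℝ}
    (hv : ∀ i, v i = icoScale⁻¹ / 2 * u i) (p : Fin 3 × Bool × Bool)
    (h : ∀ j, u j * (goldenRatio + 2) = 2 * (![!₂[0, boolSign p.2.1, boolSign p.2.2 * goldenRatio],
        !₂[boolSign p.2.1, boolSign p.2.2 * goldenRatio, 0],
        !₂[boolSign p.2.2 * goldenRatio, 0, boolSign p.2.1]] p.1 : EuclideanSpace ℝ (Fin 3)) j) :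
    v = icoVertex p := by
  ext j
  rw [hv, icoScale_inv_mul_eq (h j)]
  rfl

/-- These are the three vertices of the face and their antipodes. -/
theorem eq_icoVertex_of_coords_vertex {v : EuclideanSpace ℝ (Fin 3)} {α β γ : ℝ}
    (hv : ∀ i, v i = icoScale⁻¹ / 2 * faceCoords α β γ i) (s : Bool)
    (h : (α = boolSign s ∧ β = boolSign s * icoCos ∧ γ = boolSign s * icoCos) ∨
      (α = boolSign s * icoCos ∧ β = boolSign s ∧ γ = boolSign s * icoCos) ∨
      (α = boolSign s * icoCos ∧ β = boolSign s * icoCos ∧ γ = boolSign s)) :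
    v ∈ Set.range icoVertex := by
  have hφ := goldenRatio_sq
  generalize hσ : boolSign s = σ at h
  have hmk := fun p h => (⟨p, (eq_icoVertex_of_coords hv p h).symm⟩ : v ∈ Set.range icoVertex)
  clear hv
  rcases h with ⟨h1, h2, h3⟩ | ⟨h1, h2, h3⟩ | ⟨h1, h2, h3⟩
  · refine hmk (0, s, s) fun j => ?_
    clear hmk
    fin_cases j <;> simp [faceCoords, hσ, h1, h2, h3, icoCos] <;> grind
  · refine hmk (2, s, s) fun j => ?_
    clear hmk
    fin_cases j <;> simp [faceCoords, hσ, h1, h2, h3, icoCos] <;> grind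
  · refine hmk (1, s, s) fun j => ?_
    clear hmk
    fin_cases j <;> simp [faceCoords, hσ, h1, h2, h3, icoCos] <;> grind

/-- These are the other six vertices: one of the three signs differs from the other two. -/
theorem eq_icoVertex_of_coords_mixed {v : EuclideanSpace ℝ (Fin 3)} {α β γ : ℝ}
    (hv : ∀ i, v i = icoScale⁻¹ / 2 * faceCoords α β γ i) (s : Bool)
    (h : (α = boolSign s * icoCos ∧ β = boolSign s * icoCos ∧ γ = -(boolSign s * icoCos)) ∨
      (α = boolSign s * icoCos ∧ β = -(boolSign s * icoCos) ∧ γ = boolSign s * icoCos) ∨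
      (α = -(boolSign s * icoCos) ∧ β = boolSign s * icoCos ∧ γ = boolSign s * icoCos)) :
    v ∈ Set.range icoVertex := by
  have hφ := goldenRatio_sq
  have hn : boolSign (!s) = -boolSign s := by cases s <;> simp [boolSign]
  generalize hσ : boolSign s = σ at h hn
  have hmk := fun p h => (⟨p, (eq_icoVertex_of_coords hv p h).symm⟩ : v ∈ Set.range icoVertex)
  clear hv
  rcases h with ⟨h1, h2, h3⟩ | ⟨h1, h2, h3⟩ | ⟨h1, h2, h3⟩
  · refine hmk (0, !s, s) fun j => ?_
    clear hmk
    fin_cases j <;> simp [faceCoords, hσ, hn, h1, h2, h3, icoCos] <;> grind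
  · refine hmk (1, !s, s) fun j => ?_
    clear hmk
    fin_cases j <;> simp [faceCoords, hσ, hn, h1, h2, h3, icoCos] <;> grind
  · refine hmk (2, !s, s) fun j => ?_
    clear hmk
    fin_cases j <;> simp [faceCoords, hσ, hn, h1, h2, h3, icoCos] <;> grind

/-- Such a point lies on the axis of the face, and unit norm would force the golden ratio to be
`4/3`. -/
theorem false_of_coords_eq {v : EuclideanSpace ℝ (Fin 3)} {α : ℝ} (hα : α ^ 2 = 1 / 5)
    (hv : ∀ i, v i = icoScale⁻¹ / 2 * faceCoords α α α i) (h : ‖v‖ = 1) : False := by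
  have hφ := goldenRatio_sq
  have hS := sum_sq_of_norm_eq_one h
  rw [Fin.sum_univ_three, hv, hv, hv] at hS
  have h4 := icoScale_sq
  have h5 := icoScale_ne_zero
  have h6 : (icoScale⁻¹ / 2) ^ 2 = (goldenRatio + 2) / 4 := by
    field_simp
    linear_combination -4 * h4
  simp only [faceCoords, Matrix.cons_val] at hS
  have h8 : goldenRatio = 4 / 3 := by
    clear hv h h4 h5
    grind
  rw [h8] at hφ
  norm_num at hφ

theorem mem_icosahedronVertices_of_triangle {a b c x : EuclideanSpace ℝ (Fin 3)} (ha : ‖a‖ = 1)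
    (hb : ‖b‖ = 1) (hc : ‖c‖ = 1) (hab : inner ℝ a b = icoCos) (hbc : inner ℝ b c = icoCos)
    (hca : inner ℝ c a = icoCos)
    {f : EuclideanSpace ℝ (Fin 3) ≃ₗᵢ[ℝ] EuclideanSpace ℝ (Fin 3)}
    (hf : ∀ i, f.symm x i = icoScale⁻¹ / 2 * faceCoords (inner ℝ a x) (inner ℝ b x) (inner ℝ c x) i)
    (hx : ‖x‖ = 1)
    (hxs : ∀ y ∈ ({a, b, c} : Set (EuclideanSpace ℝ (Fin 3))), y = x ∨ inner ℝ y x = -1 ∨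
      inner ℝ y x = icoCos ∨ inner ℝ y x = -icoCos) :
    f.symm x ∈ icosahedronVertices := by
  rw [← range_icoVertex]
  have hba : inner ℝ b a = icoCos := by rw [real_inner_comm, hab]
  have hcb : inner ℝ c b = icoCos := by rw [real_inner_comm, hbc]
  have hac : inner ℝ a c = icoCos := by rw [real_inner_comm, hca]
  have hneg : ∀ y : EuclideanSpace ℝ (Fin 3), ‖y‖ = 1 → inner ℝ y x = -1 → x = -y := by
    intro y hy h
    have h1 : inner ℝ x (-y) = (1 : ℝ) := by rw [inner_neg_right, real_inner_comm, h, neg_neg]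
    exact (inner_eq_one_iff_of_norm_eq_one hx (by rw [norm_neg, hy])).1 h1
  have hT : boolSign true = 1 := rfl
  have hF : boolSign false = -1 := rfl
  have hvt := eq_icoVertex_of_coords_vertex hf
  have hmx := eq_icoVertex_of_coords_mixed hf
  have hcs := icoCos_sq
  rcases hxs a (by simp) with rfl | h | ha'
  · exact hvt true (Or.inl (by simp [ha, hba, hca, hT]))
  · obtain rfl := hneg a ha h
    exact hvt false (Or.inl (by simp [ha, hba, hca, hF]))
  rcases hxs b (by simp) with rfl | h | hb'
  · exact hvt true (Or.inr (Or.inl (by simp [hb, hab, hcb, hT])))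
  · obtain rfl := hneg b hb h
    exact hvt false (Or.inr (Or.inl (by simp [hb, hab, hcb, hF])))
  rcases hxs c (by simp) with rfl | h | hc'
  · exact hvt true (Or.inr (Or.inr (by simp [hc, hac, hbc, hT])))
  · obtain rfl := hneg c hc h
    exact hvt false (Or.inr (Or.inr (by simp [hc, hac, hbc, hF])))
  have hn : ‖f.symm x‖ = 1 := by rw [f.symm.norm_map, hx]
  -- Of the eight sign patterns, the six mixed ones give vertices and the two constant ones violate
  -- unit norm.
  rcases ha' with h1 | h1 <;> rcases hb' with h2 | h2 <;> rcases hc' with h3 | h3 <;>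
    rw [h1, h2, h3] at hf hmx
  · exact (false_of_coords_eq hcs hf hn).elim
  · exact hmx true (by simp [hT])
  · exact hmx true (by simp [hT])
  · exact hmx false (by simp [hF])
  · exact hmx true (by simp [hT])
  · exact hmx false (by simp [hF])
  · exact hmx false (by simp [hF])
  · exact (false_of_coords_eq (by rw [neg_sq, hcs]) hf hn).elim

end IcosahedronUniqueness

/-! ### Every tight 5-design contains a face and is an icosahedron -/

section IcosahedronUniqueness

open Real

namespace IsTightDesign

/-- A diagonal entry of `E_1 E_0 = 0`: `E_0` is constant and `E_1` is proportional to the Gram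
matrix. -/
theorem sum_inner_direction_eq_zero {d n : ℕ} {X : Finset (SpinFactor d)} (hd : 1 < d)
    (h : IsTightDesign (n + 1) 1 X) (hn : 1 ≤ n) {x : SpinFactor d} (hx : x ∈ X) :
    ∑ y ∈ X, inner ℝ x.direction y.direction = (0 : ℝ) := by
  have h1 := congrFun (congrFun (h.jacobiQ_mul_of_ne hd (i := 1) (j := 0) hn (Nat.zero_le n)
    one_ne_zero) ⟨x, hx⟩) ⟨x, hx⟩
  have hc : (X.card : ℝ) ≠ 0 := by exact_mod_cast (h.nonempty hd).card_pos.ne'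
  have hd0 : (d : ℝ) + 1 ≠ 0 := by positivity
  rw [Matrix.mul_apply] at h1
  have h2 : ∀ y : X, kernelMatrix X (jacobiQ 2 d 0 1) ⟨x, hx⟩ y *
      kernelMatrix X (jacobiQ 2 d 0 0) y ⟨x, hx⟩ =
      (d + 1) / (X.card : ℝ) ^ 2 * inner ℝ x.direction y.1.direction := by
    intro y
    simp only [kernelMatrix, Matrix.of_apply, eval_jacobiQ_one hd, jacobiQ_zero hd, poch_zero,
      eval_C, (h.isPrimitiveIdem x hx).ip_eq (h.isPrimitiveIdem y y.2)]
    field_simp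
    ring
  rw [Finset.sum_congr rfl fun y _ => h2 y, ← Finset.mul_sum, Matrix.zero_apply] at h1
  have h3 := (mul_eq_zero.1 h1).resolve_left (by positivity)
  rwa [Finset.sum_coe_sort X fun y => inner ℝ x.direction y.direction] at h3

theorem inner_direction_cases {X : Finset (SpinFactor 2)} (h : IsTightDesign 3 1 X)
    {x y : SpinFactor 2} (hx : x ∈ X) (hy : y ∈ X) (hxy : x ≠ y) :
    inner ℝ x.direction y.direction = -1 ∨ inner ℝ x.direction y.direction = icoCos ∨
      inner ℝ x.direction y.direction = -icoCos := by
  have h1 := ip_mem_angleSet hx hy hxy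
  rw [IsTightDesign.mem_angleSet_iff (by norm_num) h, eval_jacobiR_two_two,
    (h.isPrimitiveIdem x hx).ip_eq (h.isPrimitiveIdem y hy)] at h1
  set t : ℝ := inner ℝ x.direction y.direction
  have h2 : (t + 1) * ((t - icoCos) * (t + icoCos)) = 0 := by
    linear_combination (2 / 15) * h1 - (t + 1) * icoCos_sq
  rcases mul_eq_zero.1 h2 with h3 | h3
  · left; linarith
  · rcases mul_eq_zero.1 h3 with h4 | h4
    · right; left; linarith
    · right; right; linarith

/-- Counting by cosine gives `P + M + A + 1 = 12` and `(P - M)/√5 = A - 1` with `A ≤ 1`. The case `A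
= 0` would need `(P - M)² = 5`, so `A = 1` and `P = M = 5`. -/
theorem four_le_card_filter_inner {X : Finset (SpinFactor 2)} (h : IsTightDesign 3 1 X)
    {x : SpinFactor 2} (hx : x ∈ X) :
    4 ≤ (X.filter fun y => inner ℝ x.direction y.direction = icoCos).card := by
  classical
  have hcard : X.card = 12 := h.card_eq (n := 2) (by norm_num)
  have hsum := sum_inner_direction_eq_zero (by norm_num) h (by norm_num) hx
  have hc := icoCos_pos
  have hc1 := icoCos_lt_one
  have hunit := fun y hy => (h.isPrimitiveIdem y hy).norm_direction
  set P := X.filter fun y => inner ℝ x.direction y.direction = icoCos with hP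
  set M := X.filter fun y => inner ℝ x.direction y.direction = -icoCos with hM
  set A := X.filter fun y => inner ℝ x.direction y.direction = -1 with hA
  have hself : inner ℝ x.direction x.direction = (1 : ℝ) := by
    rw [real_inner_self_eq_norm_sq, hunit x hx, one_pow]
  -- Sums over `X` of a function of the cosine class; it is used for the cardinality and for the sum
  -- of the cosines.
  have key : ∀ p q r s : ℝ, ∑ y ∈ X, (if inner ℝ x.direction y.direction = icoCos then p else
      if inner ℝ x.direction y.direction = -icoCos then q else
      if inner ℝ x.direction y.direction = -1 then r else s) =
      P.card * p + M.card * q + A.card * r + s := by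
    intro p q r s
    have h1 : ∀ y ∈ X, (if inner ℝ x.direction y.direction = icoCos then p else
      if inner ℝ x.direction y.direction = -icoCos then q else
      if inner ℝ x.direction y.direction = -1 then r else s) =
      (if inner ℝ x.direction y.direction = icoCos then p else 0) +
      (if inner ℝ x.direction y.direction = -icoCos then q else 0) +
      (if inner ℝ x.direction y.direction = -1 then r else 0) + (if y = x then s else 0) := by
      intro y hy
      by_cases hyx : y = x
      · subst hyx
        rw [hself, if_neg hc1.ne', if_neg (by linarith), if_neg (by norm_num), if_neg hc1.ne',
          if_neg (by linarith), if_neg (by norm_num), if_pos rfl]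
        ring
      · rcases h.inner_direction_cases hx hy (Ne.symm hyx) with h2 | h2 | h2
        · rw [h2, if_neg (by linarith), if_neg (by linarith), if_pos rfl, if_neg (by linarith),
            if_neg (by linarith), if_pos rfl, if_neg hyx]
          ring
        · rw [h2, if_pos rfl, if_pos rfl, if_neg (by linarith), if_neg (by linarith), if_neg hyx]
          ring
        · rw [h2, if_neg (by linarith), if_pos rfl, if_neg (by linarith), if_pos rfl,
            if_neg (by linarith), if_neg hyx]
          ring
    rw [Finset.sum_congr rfl h1]
    simp only [Finset.sum_add_distrib, ← Finset.sum_filter, Finset.sum_const, nsmul_eq_mul]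
    rw [Finset.filter_eq' X x, if_pos hx, Finset.card_singleton]
    ring
  have e1 : (12 : ℝ) = P.card + M.card + A.card + 1 := by
    have := key 1 1 1 1
    simp only [ite_self, Finset.sum_const, hcard, nsmul_eq_mul, mul_one] at this
    exact_mod_cast this
  have e2 : P.card * icoCos - M.card * icoCos - A.card + 1 = 0 := by
    have := key icoCos (-icoCos) (-1) 1
    rw [Finset.sum_congr rfl (g := fun y => inner ℝ x.direction y.direction), hsum] at this
    · linarith
    · intro y hy
      by_cases hyx : y = x
      · subst hyx
        rw [hself, if_neg hc1.ne', if_neg (by linarith), if_neg (by norm_num)]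
      · rcases h.inner_direction_cases hx hy (Ne.symm hyx) with h2 | h2 | h2
        · rw [h2, if_neg (by linarith), if_neg (by linarith), if_pos rfl]
        · rw [h2, if_pos rfl]
        · rw [h2, if_neg (by linarith), if_pos rfl]
  have hA1 : A.card ≤ 1 := by
    refine Finset.card_le_one.2 fun y hy z hz => ?_
    have hdir : ∀ w ∈ A, w.direction = -x.direction := by
      intro w hw
      obtain ⟨hwX, hw1⟩ := Finset.mem_filter.1 hw
      refine (inner_eq_one_iff_of_norm_eq_one (𝕜 := ℝ) (hunit w hwX)
        (by rw [norm_neg, hunit x hx])).1 ?_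
      rw [inner_neg_right, real_inner_comm, hw1, neg_neg]
    rw [← (h.isPrimitiveIdem y (Finset.mem_filter.1 hy).1).ofSphere_direction,
      ← (h.isPrimitiveIdem z (Finset.mem_filter.1 hz).1).ofSphere_direction, hdir y hy, hdir z hz]
  have e1' : 12 = P.card + M.card + A.card + 1 := by exact_mod_cast e1
  have hs := icoCos_sq
  rcases Nat.le_one_iff_eq_zero_or_eq_one.1 hA1 with h0 | h0
  · exfalso
    rw [h0] at e2 e1'
    have e3 : ((P.card : ℝ) - M.card) ^ 2 = 5 := by
      push_cast at e2
      have e4 : ((P.card : ℝ) - M.card) * icoCos = -1 := by linarith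
      have e5 : (((P.card : ℝ) - M.card) * icoCos) ^ 2 = 1 := by rw [e4]; norm_num
      rw [mul_pow, hs] at e5
      linarith
    have e6 : ((P.card : ℤ) - M.card) ^ 2 = 5 := by exact_mod_cast e3
    have e7 : (P.card : ℤ) - M.card ≤ 2 := by nlinarith
    have e8 : -2 ≤ (P.card : ℤ) - M.card := by nlinarith
    generalize (P.card : ℤ) - M.card = k at e6 e7 e8
    interval_cases k <;> norm_num at e6
  · rw [h0] at e2 e1'
    have e4 : ((P.card : ℝ) - M.card) * icoCos = 0 := by push_cast at e2; linarith
    have e5 : (P.card : ℝ) = M.card := by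
      have := (mul_eq_zero.1 e4).resolve_right hc.ne'
      linarith
    have e6 : P.card = M.card := by exact_mod_cast e5
    omega

/-- Otherwise the `m ≥ 4` neighbours of `x` have pairwise cosine `-c`, `c = 1/√5`; antipodal pairs
are excluded since both cosines with `x` are positive. Their sum would have square norm `m (1 + c -
m c) < 0`, because `3c > 1`. -/
theorem exists_triangle {X : Finset (SpinFactor 2)} (h : IsTightDesign 3 1 X) :
    ∃ x ∈ X, ∃ y ∈ X, ∃ z ∈ X, inner ℝ x.direction y.direction = icoCos ∧
      inner ℝ y.direction z.direction = icoCos ∧ inner ℝ z.direction x.direction = icoCos := by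
  classical
  obtain ⟨x, hx⟩ := h.nonempty (n := 2) (by norm_num)
  have hP := h.four_le_card_filter_inner hx
  set P := X.filter fun y => inner ℝ x.direction y.direction = icoCos with hPdef
  have hc := icoCos_pos
  have hs := icoCos_sq
  have hunit := fun y hy => (h.isPrimitiveIdem y hy).norm_direction
  by_contra hcon
  push Not at hcon
  have hval : ∀ y ∈ P, ∀ z ∈ P, inner ℝ y.direction z.direction =
      (if y = z then 1 + icoCos else 0) - icoCos := by
    intro y hy z hz
    obtain ⟨hyX, hy1⟩ := Finset.mem_filter.1 hy
    obtain ⟨hzX, hz1⟩ := Finset.mem_filter.1 hz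
    split_ifs with hyz
    · subst hyz
      rw [real_inner_self_eq_norm_sq, hunit y hyX]
      ring
    · rcases h.inner_direction_cases hyX hzX hyz with h1 | h1 | h1
      · exfalso
        have h2 : y.direction = -z.direction := by
          refine (inner_eq_one_iff_of_norm_eq_one (𝕜 := ℝ) (hunit y hyX)
            (by rw [norm_neg, hunit z hzX])).1 ?_
          rw [inner_neg_right, h1, neg_neg]
        rw [h2, inner_neg_right, hz1] at hy1
        linarith
      · exact absurd (by rw [real_inner_comm, hz1]) (hcon x hx y hyX z hzX hy1 h1)
      · rw [h1, zero_sub]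
  have hnn : 0 ≤ inner ℝ (∑ y ∈ P, y.direction) (∑ y ∈ P, y.direction) := real_inner_self_nonneg
  rw [sum_inner] at hnn
  simp only [inner_sum] at hnn
  rw [Finset.sum_congr rfl fun y hy => Finset.sum_congr rfl fun z hz => hval y hy z hz] at hnn
  simp only [Finset.sum_sub_distrib, Finset.sum_ite_eq, Finset.sum_const, nsmul_eq_mul] at hnn
  rw [← Finset.sum_filter, Finset.filter_mem_eq_inter, Finset.inter_self, Finset.sum_const,
    nsmul_eq_mul] at hnn
  have hP' : (4 : ℝ) ≤ P.card := by exact_mod_cast hP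
  have h3 : 1 < 3 * icoCos := by nlinarith
  have h4 : 1 + icoCos < P.card * icoCos := by nlinarith
  have h5 : (0 : ℝ) < P.card := by linarith
  nlinarith [mul_lt_mul_of_pos_left h4 h5]

theorem isRegularIcosahedron {X : Finset (SpinFactor 2)} (h : IsTightDesign 3 1 X) :
    IsRegularIcosahedron X := by
  classical
  obtain ⟨a, ha, b, hb, c, hc, hab, hbc, hca⟩ := h.exists_triangle
  have hunit := fun y hy => (h.isPrimitiveIdem y hy).norm_direction
  obtain ⟨f, hf⟩ := exists_isometry_of_triangle (hunit a ha) (hunit b hb) (hunit c hc) hab hbc hca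
  refine ⟨f, ?_⟩
  have hsub : (X : Set (SpinFactor 2)) ⊆
      (fun v => SpinFactor.ofSphere (f v)) '' icosahedronVertices := by
    intro x hx
    refine ⟨f.symm x.direction, ?_, ?_⟩
    · refine mem_icosahedronVertices_of_triangle (hunit a ha) (hunit b hb) (hunit c hc) hab hbc hca
        (hf x.direction) (hunit x hx) ?_
      have key : ∀ y ∈ X, y.direction = x.direction ∨ inner ℝ y.direction x.direction = -1 ∨
          inner ℝ y.direction x.direction = icoCos ∨
          inner ℝ y.direction x.direction = -icoCos := by
        intro y hy
        by_cases hyx : y = x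
        · exact Or.inl (by rw [hyx])
        · exact Or.inr (h.inner_direction_cases hy hx hyx)
      rintro y (rfl | rfl | rfl)
      · exact key a ha
      · exact key b hb
      · exact key c hc
    · dsimp only
      rw [f.apply_symm_apply, (h.isPrimitiveIdem x hx).ofSphere_direction]
  -- The design has `12` points and the icosahedron at most `12`, so the inclusion is an equality.
  refine Set.eq_of_subset_of_ncard_le hsub ?_ ?_
  · rw [Set.ncard_coe_finset, show X.card = 12 from h.card_eq (n := 2) (by norm_num),
      ← range_icoVertex, ← Set.range_comp, ← Set.image_univ]
    refine (Set.ncard_image_le Set.finite_univ).trans ?_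
    rw [Set.ncard_univ, Nat.card_eq_fintype_card]
    rfl
  · rw [← range_icoVertex]
    exact (Set.finite_range _).image _

end IsTightDesign

end IcosahedronUniqueness

end

/-! ### The theorem -/

theorem mainTheorem3 :
    (∀ (d s : ℕ) (X : Finset (SpinFactor d)), 1 < d → IsTightDesign s 1 X →
      -- rationality of the angle set outside the exceptional case
      (¬ (d = 2 ∧ s = 3) → ∀ α ∈ angleSet X, ∃ q : ℚ, (q : ℝ) = α) ∧
      -- the matrices `L_0, …, L_s` are the orthogonal idempotent basis of the Bose-Mesner algebra
      (∀ i j : Fin (s + 1), schemeIdempotent X s i * schemeIdempotent X s j =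
        if i = j then schemeIdempotent X s i else 0) ∧
      LinearIndependent ℂ (fun i : Fin (s + 1) => schemeIdempotent X s i) ∧
      Submodule.span ℂ (Set.range fun i : Fin (s + 1) => schemeIdempotent X s i) =
        boseMesner X ∧
      -- their ranks
      (schemeIdempotent X s s).rank = (d + s - 2).choose (s - 1) ∧
      (2 ≤ s → (schemeIdempotent X s 1).rank = d + 1 ∧
        ((schemeIdempotent X s 1).rank = (schemeIdempotent X s s).rank ↔ d = 2 ∧ s = 3))) ∧
    -- the exceptional case: exactly the regular icosahedra, with irrational angle set
    (∃ X : Finset (SpinFactor 2), IsTightDesign 3 1 X) ∧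
    (∀ X : Finset (SpinFactor 2), IsTightDesign 3 1 X ↔ IsRegularIcosahedron X) ∧
    (∀ X : Finset (SpinFactor 2), IsTightDesign 3 1 X →
      ¬ ∀ α ∈ angleSet X, ∃ q : ℚ, (q : ℝ) = α) := by
  refine ⟨fun d s X hd h => ?_, exists_isTightDesign_three,
    fun X => ⟨IsTightDesign.isRegularIcosahedron, IsRegularIcosahedron.isTightDesign⟩,
    fun X h => h.not_rational_angleSet⟩
  -- The bound `1 ≤ s` is part of the definition of a tight design with `ε = 1`.
  obtain ⟨n, rfl⟩ : ∃ n, s = n + 1 := ⟨s - 1, by have := h.2.1; omega⟩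
  have hlast : (schemeIdempotent X (n + 1) (n + 1)).rank = (d + n - 1).choose n := by
    have := h.rank_schemeIdempotent hd ⟨n + 1, by omega⟩
    rwa [schemeMultiplicity, if_neg (by simp)] at this
  refine ⟨fun hds α hα => h.rational_angleSet hd (fun e => hds ⟨e.1, by omega⟩) hα,
    h.schemeIdempotent_mul hd, h.linearIndependent_schemeIdempotent hd,
    h.span_schemeIdempotent hd, ?_, fun hn => ?_⟩
  · rw [hlast, show d + (n + 1) - 2 = d + n - 1 by omega, Nat.add_sub_cancel]
  · have hn' : 1 ≤ n := by omega
    have hone : (schemeIdempotent X (n + 1) 1).rank = d + 1 := by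
      have := h.rank_schemeIdempotent hd ⟨1, by omega⟩
      rwa [schemeMultiplicity, if_pos hn', harmonicDim_one] at this
    refine ⟨hone, ?_⟩
    rw [hone, hlast, eq_comm, choose_eq_add_one_iff hd hn']
    exact ⟨fun e => ⟨e.1, by omega⟩, fun e => ⟨e.1, by omega⟩⟩
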